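/- Let $G(\mathcal N,\mathcal E)$ be a finite connected directed graph (buses and lines) with at most one line, and no loop, between two buses; let $\mathcal N$ be split into generator buses $\mathcal G$ and load buses $\mathcal L$, and also into control areas, and let $\mathcal E_{in}\subseteq\mathcal E$ be the set of lines joining two buses of the same area. Let $M_i>0$ $(i\in\mathcal G)$, $D_i>0$ $(i\in\mathcal N)$, $B_{ij}>0$ $(ij\in\mathcal E)$, and let $P^{in}_i,\underline d_i,\overline d_i$ $(i\in\mathcal N)$, $\underline P_{ij},\overline P_{ij}$ $(ij\in\mathcal E_{in})$ be real constants. Let $\epsilon_{d_i},\epsilon_{\psi_i},\epsilon_{\gamma_i^\pm},\epsilon_{\mu_i},K_i>0$ $(i\in\mathcal N)$ and $\epsilon_{\sigma_{ij}^\pm}>0$ $(ij\in\mathcal E_{in})$ be arbitrary, and $\epsilon_{\omega_i}=1/M_i$ $(i\in\mathcal G)$. Write $F_i(\psi)=\sum_{j:ij\in\mathcal E_{in}}B_{ij}(\psi_i-\psi_j)-\sum_{k:ki\in\mathcal E_{in}}B_{ki}(\psi_k-\psi_i)$ and $Q_i(P)=\sum_{j:ij\in\mathcal E}P_{ij}-\sum_{k:ki\in\mathcal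 E}P_{ki}$, and let $[x]^+_y=x$ if $x>0$ or $y>0$, and $[x]^+_y=0$ otherwise. Optimal load control problem: minimize $\sum_i c_i(d_i)$ over $(d,\theta)$ subject to $d_i=P^{in}_i-F_i(\theta)$ and $\underline d_i\le d_i\le\overline d_i$ for $i\in\mathcal N$, and $\underline P_{ij}\le B_{ij}(\theta_i-\theta_j)\le\overline P_{ij}$ for $ij\in\mathcal E_{in}$. Reformulated problem: minimize $\sum_i c_i(d_i)+\sum_i\frac12D_i\omega_i^2$ over $(d,\omega,P,\psi)$ subject to $d_i=P^{in}_i-D_i\omega_i-Q_i(P)$, $\underline d_i\le d_i\le\overline d_i$ and $d_i=P^{in}_i-F_i(\psi)$ for $i\in\mathcal N$, and $\underline P_{ij}\le B_{ij}(\psi_i-\psi_j)\le\overline P_{ij}$ for $ij\in\mathcal E_{in}$. Network dynamics: $M_i\dot\omega_i=-(D_i\omega_i+d_i-P^{in}_i+Q_i(P))$ for $i\in\mathcal G$, $0=D_i\omega_i+d_i-P^{in}_i+Q_i(P)$ for $i\in\mathcal L$, $\dot P_{ij}=B_{ij}(\omega_i-\omega_j)$ for $ij\in\mathcal E$. Automatic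 load control (ALC) algorithm: $$\dot d_i=\epsilon_{d_i}\Big(-c_i'(d_i)+\eta_i\omega_i+\tfrac{\epsilon_{\mu_i}}{K_i}r_i-\gamma_i^++\gamma_i^-\Big),\qquad \dot r_i=K_i\big(D_i\omega_i+Q_i(P)-F_i(\psi)\big),$$ $$\dot\psi_i=\epsilon_{\psi_i}\Big[\sum_{j:ij\in\mathcal E_{in}}(\mu_i-\mu_j-\sigma_{ij}^++\sigma_{ij}^-)B_{ij}+\sum_{k:ki\in\mathcal E_{in}}(\mu_i-\mu_k+\sigma_{ki}^+-\sigma_{ki}^-)B_{ki}\Big],$$ $$\dot\gamma_i^+=\epsilon_{\gamma_i^+}[d_i-\overline d_i]^+_{\gamma_i^+},\qquad \dot\gamma_i^-=\epsilon_{\gamma_i^-}[-d_i+\underline d_i]^+_{\gamma_i^-},$$ $$\dot\sigma_{ij}^+=\epsilon_{\sigma_{ij}^+}[B_{ij}(\psi_i-\psi_j)-\overline P_{ij}]^+_{\sigma_{ij}^+},\qquad \dot\sigma_{ij}^-=\epsilon_{\sigma_{ij}^-}[-B_{ij}(\psi_i-\psi_j)+\underline P_{ij}]^+_{\sigma_{ij}^-},$$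 where for $i\in\mathcal G$: $\eta_i=(\epsilon_{\omega_i}+\epsilon_{\mu_i})/\epsilon_{\omega_i}$ and $\mu_i=\frac{\epsilon_{\mu_i}}{\epsilon_{\omega_i}}\omega_i+\frac{\epsilon_{\mu_i}}{K_i}r_i$, and for $i\in\mathcal L$: $\eta_i=1$ and $\mu_i=\frac{\epsilon_{\mu_i}}{K_i}r_i$. **Theorem.** Assume that every $c_i:\mathbb R\to\mathbb R$ is strictly convex and continuously differentiable and that the optimal load control problem is feasible. Then the closed loop of the network dynamics and the ALC algorithm converges globally and asymptotically: for every initial state with $\gamma^\pm,\sigma^\pm\ge0$ that satisfies the power balance equations at the load buses, the closed loop has a solution on $[0,\infty)$ in the sense of Carathéodory (absolutely continuous on bounded intervals, differential equations satisfied almost everywhere, power balance at the load buses at all times), and every such solution converges, as $t\to\infty$, to a point $(d^*,\omega^*,P^*,\psi^*,\gamma^*,r^*,\sigma^*)$, which may depend on the initial state. This point is an equilibrium of the closed loop, $(d^*,\omega^*,P^*,\psi^*)$ is an optimal solution of the reformulated problem, and $\omega^*=0$. -/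

import Mathlib

noncomputable section

namespace ALC

/-- A power network: buses `N`, a set `E` of directed transmission lines, control areas (the fibres
of `area`), generator buses `gen` (the other buses are load buses), and the physical data.  The line
`(i, j)` carries the data `B i j`, `Plo i j`, `Phi i j`. -/
structure Network (N A : Type*) [Fintype N] [DecidableEq N] where
  /-- the lines, each with an arbitrary orientation -/
  E : Finset (N × N)
  /-- the control area that a bus belongs to -/
  area : N → A
  /-- the generator buses -/
  gen : Finset N
  /-- generator inertia (used at generator buses only) -/
  M : N → ℝ
  /-- damping -/
  D : N → ℝ
  /-- line constants -/
  B : N → N → ℝ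
  /-- uncontrollable power injection -/
  Pin : N → ℝ
  /-- lower load limits -/
  dlo : N → ℝ
  /-- upper load limits -/
  dhi : N → ℝ
  /-- lower thermal limits -/
  Plo : N → N → ℝ
  /-- upper thermal limits -/
  Phi : N → N → ℝ
  E_asymm : ∀ i j, (i, j) ∈ E → (j, i) ∉ E
  connected : (SimpleGraph.fromRel (fun i j => (i, j) ∈ E)).Connected
  M_pos : ∀ i ∈ gen, 0 < M i
  D_pos : ∀ i, 0 < D i
  B_pos : ∀ i j, (i, j) ∈ E → 0 < B i j

/-- Positive step sizes and gains of the controller. -/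
structure Gains (N : Type*) where
  εd : N → ℝ
  εψ : N → ℝ
  εγp : N → ℝ
  εγm : N → ℝ
  εμ : N → ℝ
  K : N → ℝ
  εσp : N → N → ℝ
  εσm : N → N → ℝ
  εd_pos : ∀ i, 0 < εd i
  εψ_pos : ∀ i, 0 < εψ i
  εγp_pos : ∀ i, 0 < εγp i
  εγm_pos : ∀ i, 0 < εγm i
  εμ_pos : ∀ i, 0 < εμ i
  K_pos : ∀ i, 0 < K i
  εσp_pos : ∀ i j, 0 < εσp i j
  εσm_pos : ∀ i j, 0 < εσm i j

variable {N A : Type*} [Fintype N] [DecidableEq N] [DecidableEq A]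

/-- The lines inside a control area. -/
def Network.Ein (net : Network N A) : Finset (N × N) :=
  net.E.filter (fun e => net.area e.1 = net.area e.2)

/-- For a flow `f` on the lines `S`, the net flow leaving bus `i`:
`∑_{j : ij ∈ S} f_ij - ∑_{k : ki ∈ S} f_ki`. -/
def netOutflow {S : Finset (N × N)} (f : ↥S → ℝ) (i : N) : ℝ :=
  (∑ e : ↥S with e.1.1 = i, f e) - ∑ e : ↥S with e.1.2 = i, f e

/-- The flow `B_ij (θ_i - θ_j)` on the lines inside the control areas. -/
def Network.innerFlow (net : Network N A) (θ : N → ℝ) (e : ↥net.Ein) : ℝ :=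
  net.B e.1.1 e.1.2 * (θ e.1.1 - θ e.1.2)

/-- Feasibility of `(d, θ)` in the optimal load control problem. -/
structure Network.OLCFeasible (net : Network N A) (d θ : N → ℝ) : Prop where
  balance : ∀ i, d i = net.Pin i - netOutflow (net.innerFlow θ) i
  load_limits : ∀ i, net.dlo i ≤ d i ∧ d i ≤ net.dhi i
  thermal_limits : ∀ e : ↥net.Ein,
    net.Plo e.1.1 e.1.2 ≤ net.innerFlow θ e ∧ net.innerFlow θ e ≤ net.Phi e.1.1 e.1.2

/-- Feasibility of `(d, ω, P, ψ)` in the reformulated problem. -/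
structure Network.OPFeasible (net : Network N A) (d ω : N → ℝ) (P : ↥net.E → ℝ) (ψ : N → ℝ) :
    Prop where
  balance : ∀ i, d i = net.Pin i - net.D i * ω i - netOutflow P i
  load_limits : ∀ i, net.dlo i ≤ d i ∧ d i ≤ net.dhi i
  virtual_balance : ∀ i, d i = net.Pin i - netOutflow (net.innerFlow ψ) i
  thermal_limits : ∀ e : ↥net.Ein,
    net.Plo e.1.1 e.1.2 ≤ net.innerFlow ψ e ∧ net.innerFlow ψ e ≤ net.Phi e.1.1 e.1.2

/-- Objective of the reformulated problem. -/
def Network.opCost (net : Network N A) (c : N → ℝ → ℝ) (d ω : N → ℝ) : ℝ :=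
  ∑ i, c i (d i) + ∑ i, 1 / 2 * net.D i * ω i ^ 2

/-- `(d, ω, P, ψ)` is an optimal solution of the reformulated problem. -/
def Network.IsOptimal (net : Network N A) (c : N → ℝ → ℝ)
    (d ω : N → ℝ) (P : ↥net.E → ℝ) (ψ : N → ℝ) : Prop :=
  net.OPFeasible d ω P ψ ∧
    ∀ d' ω' P' ψ', net.OPFeasible d' ω' P' ψ' → net.opCost c d ω ≤ net.opCost c d' ω'

/-- States `(d, ω, P, ψ, γ⁺, γ⁻, r, σ⁺, σ⁻)` of the closed loop. -/
@[ext]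
structure State (net : Network N A) where
  d : N → ℝ
  ω : N → ℝ
  P : ↥net.E → ℝ
  ψ : N → ℝ
  γp : N → ℝ
  γm : N → ℝ
  r : N → ℝ
  σp : ↥net.Ein → ℝ
  σm : ↥net.Ein → ℝ

/-- The positive projection `[x]⁺_y`. -/
def posProj (x y : ℝ) : ℝ := if 0 < x ∨ 0 < y then x else 0

namespace State

variable {net : Network N A}

/-- `D_i ω_i + d_i - P^in_i + ∑_j P_ij - ∑_k P_ki`. -/
def imbalance (s : State net) (i : N) : ℝ :=
  net.D i * s.ω i + s.d i - net.Pin i + netOutflow s.P i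

/-- The frequency step size at generator buses. -/
def εω (net : Network N A) (i : N) : ℝ := 1 / net.M i

/-- The factor of the frequency in the load update. -/
def η (net : Network N A) (g : Gains N) (i : N) : ℝ :=
  if i ∈ net.gen then (εω net i + g.εμ i) / εω net i else 1

/-- The quantity `μ_i` communicated to the neighbours. -/
def μ (g : Gains N) (s : State net) (i : N) : ℝ :=
  if i ∈ net.gen then g.εμ i / εω net i * s.ω i + g.εμ i / g.K i * s.r i
  else g.εμ i / g.K i * s.r i

/-- Time derivative of `ω_i` at a generator bus. -/
def rateω (s : State net) (i : N) : ℝ := -s.imbalance i / net.M i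

/-- Time derivative of `P_ij`. -/
def rateP (s : State net) (e : ↥net.E) : ℝ :=
  net.B e.1.1 e.1.2 * (s.ω e.1.1 - s.ω e.1.2)

/-- Time derivative of `d_i`. -/
def rated (g : Gains N) (c : N → ℝ → ℝ) (s : State net) (i : N) : ℝ :=
  g.εd i * (-deriv (c i) (s.d i) + η net g i * s.ω i + g.εμ i / g.K i * s.r i
    - s.γp i + s.γm i)

/-- Time derivative of `ψ_i`. -/
def rateψ (g : Gains N) (s : State net) (i : N) : ℝ :=
  g.εψ i *
    ((∑ e : ↥net.Ein with e.1.1 = i,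
        (s.μ g i - s.μ g e.1.2 - s.σp e + s.σm e) * net.B e.1.1 e.1.2) +
      ∑ e : ↥net.Ein with e.1.2 = i,
        (s.μ g i - s.μ g e.1.1 + s.σp e - s.σm e) * net.B e.1.1 e.1.2)

/-- Time derivative of `γ⁺_i`. -/
def rateγp (g : Gains N) (s : State net) (i : N) : ℝ :=
  g.εγp i * posProj (s.d i - net.dhi i) (s.γp i)

/-- Time derivative of `γ⁻_i`. -/
def rateγm (g : Gains N) (s : State net) (i : N) : ℝ :=
  g.εγm i * posProj (-s.d i + net.dlo i) (s.γm i)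

/-- Time derivative of `r_i`. -/
def rater (g : Gains N) (s : State net) (i : N) : ℝ :=
  g.K i * (net.D i * s.ω i + netOutflow s.P i - netOutflow (net.innerFlow s.ψ) i)

/-- Time derivative of `σ⁺_ij`. -/
def rateσp (g : Gains N) (s : State net) (e : ↥net.Ein) : ℝ :=
  g.εσp e.1.1 e.1.2 * posProj (net.innerFlow s.ψ e - net.Phi e.1.1 e.1.2) (s.σp e)

/-- Time derivative of `σ⁻_ij`. -/
def rateσm (g : Gains N) (s : State net) (e : ↥net.Ein) : ℝ :=
  g.εσm e.1.1 e.1.2 * posProj (-net.innerFlow s.ψ e + net.Plo e.1.1 e.1.2) (s.σm e)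

/-- Admissible states: power is balanced at the load buses (where the frequency is determined
algebraically), and the multipliers of the inequality constraints are nonnegative. -/
structure Admissible (s : State net) : Prop where
  balance : ∀ i, i ∉ net.gen → s.imbalance i = 0
  γp_nonneg : ∀ i, 0 ≤ s.γp i
  γm_nonneg : ∀ i, 0 ≤ s.γm i
  σp_nonneg : ∀ e, 0 ≤ s.σp e
  σm_nonneg : ∀ e, 0 ≤ s.σm e

/-- Equilibria (steady states) of the closed loop. -/
structure IsEquilibrium (g : Gains N) (c : N → ℝ → ℝ) (s : State net) : Prop where
  admissible : s.Admissible
  ω : ∀ i ∈ net.gen, s.rateω i = 0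
  P : ∀ e, s.rateP e = 0
  d : ∀ i, s.rated g c i = 0
  ψ : ∀ i, s.rateψ g i = 0
  γp : ∀ i, s.rateγp g i = 0
  γm : ∀ i, s.rateγm g i = 0
  r : ∀ i, s.rater g i = 0
  σp : ∀ e, s.rateσp g e = 0
  σm : ∀ e, s.rateσm g e = 0

end State

/-- `f` solves `f' = rate` on `[0, ∞)` in the sense of Carathéodory. -/
def CaratheodoryODE (f rate : ℝ → ℝ) : Prop :=
  (∀ T : ℝ, 0 < T → AbsolutelyContinuousOnInterval f 0 T) ∧
    ∀ᵐ t ∂(MeasureTheory.volume.restrict (Set.Ioi (0 : ℝ))), HasDerivAt f (rate t) t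

/-- `x` is a solution on `[0, ∞)` of the closed loop of the network dynamics and the controller. -/
structure IsSolution {net : Network N A} (g : Gains N) (c : N → ℝ → ℝ) (x : ℝ → State net) :
    Prop where
  balance : ∀ t, 0 ≤ t → ∀ i, i ∉ net.gen → 0 = (x t).imbalance i
  ω : ∀ i ∈ net.gen, CaratheodoryODE (fun t => (x t).ω i) (fun t => (x t).rateω i)
  P : ∀ e, CaratheodoryODE (fun t => (x t).P e) (fun t => (x t).rateP e)
  d : ∀ i, CaratheodoryODE (fun t => (x t).d i) (fun t => (x t).rated g c i)
  ψ : ∀ i, CaratheodoryODE (fun t => (x t).ψ i) (fun t => (x t).rateψ g i)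
  γp : ∀ i, CaratheodoryODE (fun t => (x t).γp i) (fun t => (x t).rateγp g i)
  γm : ∀ i, CaratheodoryODE (fun t => (x t).γm i) (fun t => (x t).rateγm g i)
  r : ∀ i, CaratheodoryODE (fun t => (x t).r i) (fun t => (x t).rater g i)
  σp : ∀ e, CaratheodoryODE (fun t => (x t).σp e) (fun t => (x t).rateσp g e)
  σm : ∀ e, CaratheodoryODE (fun t => (x t).σm e) (fun t => (x t).rateσm g e)

/-- Convergence of all components of `x t` to those of `s` as `t → ∞`. -/
structure ConvergesTo {net : Network N A} (x : ℝ → State net) (s : State net) : Prop where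
  d : Filter.Tendsto (fun t => (x t).d) Filter.atTop (nhds s.d)
  ω : Filter.Tendsto (fun t => (x t).ω) Filter.atTop (nhds s.ω)
  P : Filter.Tendsto (fun t => (x t).P) Filter.atTop (nhds s.P)
  ψ : Filter.Tendsto (fun t => (x t).ψ) Filter.atTop (nhds s.ψ)
  γp : Filter.Tendsto (fun t => (x t).γp) Filter.atTop (nhds s.γp)
  γm : Filter.Tendsto (fun t => (x t).γm) Filter.atTop (nhds s.γm)
  r : Filter.Tendsto (fun t => (x t).r) Filter.atTop (nhds s.r)
  σp : Filter.Tendsto (fun t => (x t).σp) Filter.atTop (nhds s.σp)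
  σm : Filter.Tendsto (fun t => (x t).σm) Filter.atTop (nhds s.σm)

end ALC

end

/-!
In the coordinates `d`, `ω` (at generator buses), `P`, `ψ`, `μ`, `γ`, `σ`, where `μ` replaces `r` and
the frequencies at load buses are eliminated, the closed loop is the primal-dual gradient flow of a
Lagrangian of the reformulated problem, projected so that `γ` and `σ` stay nonnegative: up to step
sizes, `x' = F(x)` plus a reaction force of the constraints.  All terms of `F` that are bilinear in
primal and dual variables cancel in `⟨F(x) - F(y), x - y⟩`, which is therefore
`-∑ (c_i'(d_i) - c_i'(d_i')) (d_i - d_i') - ∑ D_i (ω_i - ω_i')² ≤ 0`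
(`Coord.sum_field_sub_mul_sub`).  Hence two solutions never move apart in the norm weighted by the
step sizes (`IsProjSolution.energy_sub_antitone`).

An equilibrium exists because the flows of the optimal load control problem range over a compact set,
so a minimizer exists, and because its constraints are affine, so Farkas' lemma yields multipliers
(`Coord.exists_isProjEquilibrium`).  Conversely every equilibrium satisfies the Karush-Kuhn-Tucker
conditions, with vanishing frequencies since the network is connected, and is thus optimal
(`Coord.freq_eq_zero`, `Coord.isOptimal_toState`).

Since `c_i'` is merely continuous and the projection is discontinuous, existence of solutions is also
drawn from monotonicity (`exists_isProjSolution`): `c_i'` is replaced by averages that are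
continuously differentiable and monotone, and the projection by a smooth penalty, in such a way that
a given equilibrium survives.  The distance to it bounds the solutions of the smooth problems, and
monotonicity makes them a Cauchy sequence.  The limit is Lipschitz continuous, and its derivative is
identified wherever it exists.

Convergence follows LaSalle's principle (`IsProjSolution.exists_tendsto`): a solution that starts at
a limit point keeps its distance from an equilibrium, so nothing is dissipated along it.  For the
closed loop this fixes `d` and `ω`, hence `P`, `γ`, `μ` and the net outflows of the virtual flows.
A virtual flow comes from a potential `ψ`, so its net outflows determine it; this fixes `σ` as well,
and `ψ`, being affine in time and bounded, is constant.  So every limit point is an equilibrium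
(`Coord.isProjEquilibrium_of_energy_const`), and as the distance to it decreases, the solution
converges to it.
-/

namespace ALC

open Set Filter MeasureTheory
open scoped Topology

/-! ### Absolutely continuous functions on the half-line -/

theorem _root_.AbsolutelyContinuousOnInterval.le_of_ae_deriv_nonpos {f f' : ℝ → ℝ} {a b : ℝ}
    (hab : a ≤ b) (hf : AbsolutelyContinuousOnInterval f a b)
    (hd : ∀ᵐ t, t ∈ Ioo a b → HasDerivAt f (f' t) t ∧ f' t ≤ 0) : f b ≤ f a := by
  have h := hf.integral_deriv_eq_sub
  have h2 : ∫ x in a..b, deriv f x ≤ 0 := by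
    rw [intervalIntegral.integral_of_le hab, ← Measure.restrict_congr_set Ioo_ae_eq_Ioc]
    apply integral_nonpos_of_ae
    rw [EventuallyLE, ae_restrict_iff' measurableSet_Ioo]
    filter_upwards [hd] with t ht hmem
    rw [(ht hmem).1.deriv]
    exact (ht hmem).2
  linarith

/-- A bound from below persists if the function does not decrease while the bound is violated. -/
theorem ge_of_le_while_below {f : ℝ → ℝ} {T b : ℝ} (hcont : ContinuousOn f (Icc 0 T))
    (h0 : b ≤ f 0) (H : ∀ s t, 0 ≤ s → s ≤ t → t ≤ T → (∀ r ∈ Ioo s t, f r < b) → f s ≤ f t)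
    {t : ℝ} (ht : t ∈ Icc 0 T) : b ≤ f t := by
  -- `s` is the last time up to `t` at which the bound holds
  set S := Icc 0 t ∩ {r | b ≤ f r} with hS
  have hcl : IsClosed S :=
    (hcont.mono (Icc_subset_Icc_right ht.2)).preimage_isClosed_of_isClosed isClosed_Icc isClosed_Ici
  have hcomp : IsCompact S := isCompact_Icc.of_isClosed_subset hcl inter_subset_left
  obtain ⟨s, hsS, hmax⟩ := hcomp.exists_isGreatest ⟨0, ⟨le_rfl, ht.1⟩, h0⟩
  refine le_trans hsS.2 (H s t hsS.1.1 hsS.1.2 ht.2 fun r hr => ?_)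
  by_contra! hb
  exact absurd (hmax ⟨⟨hsS.1.1.trans hr.1.le, hr.2.le⟩, hb⟩) (not_le.2 hr.1)

namespace CaratheodoryODE

variable {f g u v : ℝ → ℝ}

theorem absolutelyContinuousOnInterval (hf : CaratheodoryODE f u) {a b : ℝ} (ha : 0 ≤ a)
    (hab : a ≤ b) : AbsolutelyContinuousOnInterval f a b := by
  refine (hf.1 (b + 1) (by linarith)).mono ?_
  rw [uIcc_of_le hab, uIcc_of_le (by linarith)]
  exact Icc_subset_Icc ha (by linarith)

theorem continuousOn (hf : CaratheodoryODE f u) : ContinuousOn f (Ici 0) := by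
  intro t ht
  have h := (hf.1 (t + 1) (by linarith [mem_Ici.1 ht])).continuousOn
  rw [uIcc_of_le (by linarith [mem_Ici.1 ht])] at h
  refine (h t ⟨ht, by linarith⟩).mono_of_mem_nhdsWithin ?_
  rw [← Ici_inter_Iic]
  exact inter_mem_nhdsWithin _ (Iic_mem_nhds (by linarith))

theorem ae_hasDerivAt (hf : CaratheodoryODE f u) : ∀ᵐ t, 0 < t → HasDerivAt f (u t) t :=
  (ae_restrict_iff' measurableSet_Ioi).1 hf.2

theorem congr_rate (hf : CaratheodoryODE f u) (h : ∀ t, 0 ≤ t → u t = v t) :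
    CaratheodoryODE f v := by
  refine ⟨hf.1, (ae_restrict_iff' measurableSet_Ioi).2 ?_⟩
  filter_upwards [hf.ae_hasDerivAt] with t ht h0
  rw [← h t (le_of_lt h0)]
  exact ht h0

theorem congr_fun (hf : CaratheodoryODE f u) (h : ∀ t, 0 ≤ t → f t = g t) :
    CaratheodoryODE g u := by
  refine ⟨fun T hT => ?_, (ae_restrict_iff' measurableSet_Ioi).2 ?_⟩
  · have h1 := hf.1 T hT
    rw [absolutelyContinuousOnInterval_iff] at h1 ⊢
    intro ε hε
    obtain ⟨δ, hδ, H⟩ := h1 ε hε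
    refine ⟨δ, hδ, fun E hE hlt => ?_⟩
    convert H E hE hlt using 1
    refine Finset.sum_congr rfl fun i hi => ?_
    have h2 := hE.1 i hi
    rw [uIcc_of_le hT.le] at h2
    rw [h _ h2.1.1, h _ h2.2.1]
  · filter_upwards [hf.ae_hasDerivAt] with t ht h0
    refine (ht h0).congr_of_eventuallyEq ?_
    filter_upwards [Ioi_mem_nhds h0] with s hs
    exact (h s (le_of_lt hs)).symm

theorem comp_const_add (hf : CaratheodoryODE f u) {a : ℝ} (ha : 0 ≤ a) :
    CaratheodoryODE (fun t => f (a + t)) (fun t => u (a + t)) := by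
  refine ⟨fun T hT => ?_, (ae_restrict_iff' measurableSet_Ioi).2 ?_⟩
  · have h := hf.absolutelyContinuousOnInterval ha (le_add_of_nonneg_right hT.le)
    rw [absolutelyContinuousOnInterval_iff] at h ⊢
    intro e he
    obtain ⟨δ, hδ, H⟩ := h e he
    refine ⟨δ, hδ, fun E hE hlt => ?_⟩
    have key := H (E.1, fun k => (a + (E.2 k).1, a + (E.2 k).2)) ?_ (by simpa using hlt)
    · simpa using key
    · refine ⟨fun k hk => ?_, fun k hk l hl hkl => ?_⟩
      · have := hE.1 k hk
        rw [uIcc_of_le hT.le] at this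
        rw [uIcc_of_le (by linarith)]
        simp only [mem_Icc] at this ⊢
        exact ⟨⟨by linarith [this.1.1], by linarith [this.1.2]⟩,
          ⟨by linarith [this.2.1], by linarith [this.2.2]⟩⟩
      · have := hE.2 hk hl hkl
        simp only [Function.onFun, Set.disjoint_left, mem_uIoc] at this ⊢
        intro r hr hr'
        refine @this (r - a) ?_ ?_
        · rcases hr with h | h
          · exact Or.inl ⟨by linarith [h.1], by linarith [h.2]⟩
          · exact Or.inr ⟨by linarith [h.1], by linarith [h.2]⟩
        · rcases hr' with h | h
          · exact Or.inl ⟨by linarith [h.1], by linarith [h.2]⟩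
          · exact Or.inr ⟨by linarith [h.1], by linarith [h.2]⟩
  · have hq := (measurePreserving_add_left volume a).quasiMeasurePreserving.ae
      hf.ae_hasDerivAt
    filter_upwards [hq] with t ht h0
    have h0' : 0 < t := h0
    exact (ht (by linarith)).comp_const_add a t

theorem add (hf : CaratheodoryODE f u) (hg : CaratheodoryODE g v) :
    CaratheodoryODE (fun t => f t + g t) (fun t => u t + v t) := by
  refine ⟨fun T hT => (hf.1 T hT).add (hg.1 T hT), ?_⟩
  filter_upwards [hf.2, hg.2] with t h1 h2 using h1.add h2

theorem const_mul (k : ℝ) (hf : CaratheodoryODE f u) :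
    CaratheodoryODE (fun t => k * f t) (fun t => k * u t) := by
  refine ⟨fun T hT => (hf.1 T hT).const_mul k, ?_⟩
  filter_upwards [hf.2] with t h1 using h1.const_mul k

theorem sub (hf : CaratheodoryODE f u) (hg : CaratheodoryODE g v) :
    CaratheodoryODE (fun t => f t - g t) (fun t => u t - v t) := by
  refine ⟨fun T hT => (hf.1 T hT).sub (hg.1 T hT), ?_⟩
  filter_upwards [hf.2, hg.2] with t h1 h2 using h1.sub h2

theorem mul (hf : CaratheodoryODE f u) (hg : CaratheodoryODE g v) :
    CaratheodoryODE (fun t => f t * g t) (fun t => u t * g t + f t * v t) := by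
  refine ⟨fun T hT => (hf.1 T hT).mul (hg.1 T hT), ?_⟩
  filter_upwards [hf.2, hg.2] with t h1 h2 using h1.mul h2

/-- Lipschitz functions are absolutely continuous. -/
theorem of_lipschitzWith {K : NNReal} (hf : LipschitzWith K f)
    (hu : ∀ᵐ t, 0 < t → HasDerivAt f (u t) t) : CaratheodoryODE f u :=
  ⟨fun _ _ => (hf.lipschitzOnWith).absolutelyContinuousOnInterval,
    (ae_restrict_iff' measurableSet_Ioi).2 hu⟩

theorem const (k : ℝ) : CaratheodoryODE (fun _ => k) (fun _ => 0) :=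
  of_lipschitzWith (LipschitzWith.const k) (Eventually.of_forall fun t _ => hasDerivAt_const t k)

theorem id_linear (k : ℝ) : CaratheodoryODE (fun t => k * t) (fun _ => k) := by
  have h : CaratheodoryODE (fun t => t) (fun _ => 1) :=
    of_lipschitzWith LipschitzWith.id (Eventually.of_forall fun t _ => hasDerivAt_id t)
  simpa using h.const_mul k

theorem sum {ι : Type*} (s : Finset ι) {f u : ι → ℝ → ℝ} (h : ∀ i, CaratheodoryODE (f i) (u i)) :
    CaratheodoryODE (fun t => ∑ i ∈ s, f i t) (fun t => ∑ i ∈ s, u i t) := by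
  classical
  induction s using Finset.induction_on with
  | empty => simpa using const 0
  | insert a s ha ih => simpa [Finset.sum_insert ha] using (h a).add ih

theorem le_of_rate_nonpos (hf : CaratheodoryODE f u) (hu : ∀ t, 0 ≤ t → u t ≤ 0) {s t : ℝ}
    (hs : 0 ≤ s) (hst : s ≤ t) : f t ≤ f s := by
  refine (hf.absolutelyContinuousOnInterval hs hst).le_of_ae_deriv_nonpos hst (f' := u) ?_
  filter_upwards [hf.ae_hasDerivAt] with r hr hmem
  have : 0 < r := hs.trans_lt hmem.1
  exact ⟨hr this, hu r this.le⟩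

theorem eq_of_rate_eq_zero (hf : CaratheodoryODE f u) (hu : ∀ t, 0 ≤ t → u t = 0) {t : ℝ}
    (ht : 0 ≤ t) : f t = f 0 := by
  refine le_antisymm (hf.le_of_rate_nonpos (fun t ht => (hu t ht).le) le_rfl ht) ?_
  have := (hf.const_mul (-1)).le_of_rate_nonpos (fun t ht => by simp [hu t ht]) le_rfl ht
  linarith

theorem eq_affine_of_rate_eq_const (hf : CaratheodoryODE f u) {k : ℝ}
    (hu : ∀ t, 0 ≤ t → u t = k) {t : ℝ} (ht : 0 ≤ t) : f t = f 0 + k * t := by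
  have := (hf.sub (id_linear k)).eq_of_rate_eq_zero (fun t ht => by simp [hu t ht]) ht
  simp only [mul_zero, sub_zero] at this
  linarith

/-- A bound from below persists if the rate is nonnegative wherever the bound is violated. -/
theorem ge_of_rate_nonneg (hf : CaratheodoryODE f u) {b : ℝ} (h0 : b ≤ f 0)
    (hu : ∀ t, 0 ≤ t → f t < b → 0 ≤ u t) {t : ℝ} (ht : 0 ≤ t) : b ≤ f t := by
  refine ge_of_le_while_below (T := t) (hf.continuousOn.mono Icc_subset_Ici_self) h0
    (fun r s hr hrs _ hlt => ?_) ⟨ht, le_rfl⟩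
  have h := ((hf.const_mul (-1)).absolutelyContinuousOnInterval hr hrs).le_of_ae_deriv_nonpos
    hrs (f' := fun r => -1 * u r) (by
      filter_upwards [(hf.const_mul (-1)).ae_hasDerivAt] with a ha hmem
      have h0a : 0 < a := hr.trans_lt hmem.1
      exact ⟨ha h0a, by linarith [hu a h0a.le (hlt a hmem)]⟩)
  linarith

/-- If `f` is constant, then its rate `u` vanishes almost everywhere; a continuous function `w` that
vanishes wherever `u` does then vanishes at all times. -/
theorem rate_eq_zero_of_const (hf : CaratheodoryODE f u) (hc : ∀ t, 0 ≤ t → f t = f 0) {w : ℝ → ℝ}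
    (hw : ContinuousOn w (Ici 0)) (huw : ∀ t, 0 ≤ t → u t = 0 → w t = 0) {t : ℝ} (ht : 0 ≤ t) :
    w t = 0 := by
  have hae : w =ᵐ[volume.restrict (Ici 0)] fun _ => (0 : ℝ) := by
    rw [← Measure.restrict_congr_set Ioi_ae_eq_Ici]
    refine (ae_restrict_iff' measurableSet_Ioi).2 ?_
    filter_upwards [hf.ae_hasDerivAt] with s hs h0
    refine huw s (le_of_lt h0) ((hs h0).unique ?_)
    refine (hasDerivAt_const s (f 0)).congr_of_eventuallyEq ?_
    filter_upwards [Ioi_mem_nhds h0] with r hr using hc r (le_of_lt hr)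
  exact Measure.eqOn_of_ae_eq hae hw continuousOn_const (by simp) ht

end CaratheodoryODE

/-! ### Projected monotone dynamics -/

theorem posProj_nonneg_of_nonpos {x y : ℝ} (hy : y ≤ 0) : 0 ≤ posProj x y := by
  unfold posProj
  split_ifs with h
  · rcases h with h | h <;> linarith
  · exact le_rfl

/-- The positive projection only adds a reaction force that is nonnegative and acts on the boundary:
this is what makes projected dynamics dissipative whenever the unprojected ones are. -/
theorem exists_posProj_eq_add (x : ℝ) {y : ℝ} (hy : 0 ≤ y) :
    ∃ k, 0 ≤ k ∧ k * y = 0 ∧ posProj x y = x + k := by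
  unfold posProj
  split_ifs with h
  · exact ⟨0, le_rfl, by simp, by simp⟩
  · push Not at h
    exact ⟨-x, by linarith, by rw [le_antisymm h.2 hy, mul_zero], by simp⟩

theorem posProj_eq_zero_iff {x y : ℝ} (hy : 0 ≤ y) : posProj x y = 0 ↔ x ≤ 0 ∧ x * y = 0 := by
  unfold posProj
  constructor
  · intro h
    split_ifs at h with h1
    · simp [h]
    · push Not at h1
      exact ⟨h1.1, by rw [le_antisymm h1.2 hy, mul_zero]⟩
  · rintro ⟨h1, h2⟩
    split_ifs with h
    · rcases h with h | h
      · linarith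
      · rcases mul_eq_zero.1 h2 with h2 | h2
        · exact h2
        · linarith
    · rfl

variable {ι : Type*} [Fintype ι]

open Classical in
/-- The field `F` with the coordinates in `J` projected so that they stay nonnegative. -/
noncomputable def projField (J : Set ι) (F : (ι → ℝ) → ι → ℝ) (x : ι → ℝ) (i : ι) : ℝ :=
  if i ∈ J then posProj (F x i) (x i) else F x i

/-- Solutions of `x_i' = ε_i F_i(x)`, with the coordinates in `J` projected. -/
def IsProjSolution (ε : ι → ℝ) (J : Set ι) (F : (ι → ℝ) → ι → ℝ) (x : ℝ → ι → ℝ) : Prop :=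
  ∀ i, CaratheodoryODE (fun t => x t i) (fun t => ε i * projField J F (x t) i)

/-- Equilibria of the projected dynamics. -/
def IsProjEquilibrium (J : Set ι) (F : (ι → ℝ) → ι → ℝ) (z : ι → ℝ) : Prop :=
  (∀ i ∈ J, 0 ≤ z i) ∧ ∀ i, projField J F z i = 0

/-- The field `F` is dissipative: `-F` is a monotone operator. -/
def Dissipative (F : (ι → ℝ) → ι → ℝ) : Prop :=
  ∀ x y, ∑ i, (F x i - F y i) * (x i - y i) ≤ 0

/-- The square of the norm, weighted by the step sizes `ε`, in which the dynamics are nonexpansive. -/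
noncomputable def energy (ε : ι → ℝ) (z : ι → ℝ) : ℝ := ∑ i, z i ^ 2 / ε i

section

variable {ε : ι → ℝ} {J : Set ι} {F : (ι → ℝ) → ι → ℝ}

theorem energy_nonneg (hε : ∀ i, 0 < ε i) (z : ι → ℝ) : 0 ≤ energy ε z :=
  Finset.sum_nonneg fun i _ => div_nonneg (sq_nonneg _) (hε i).le

theorem sq_le_mul_energy (hε : ∀ i, 0 < ε i) (z : ι → ℝ) (i : ι) :
    z i ^ 2 ≤ ε i * energy ε z := by
  have h : z i ^ 2 / ε i ≤ energy ε z :=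
    Finset.single_le_sum (f := fun i => z i ^ 2 / ε i)
      (fun i _ => div_nonneg (sq_nonneg _) (hε i).le) (Finset.mem_univ i)
  rw [div_le_iff₀ (hε i)] at h
  linarith

theorem continuous_energy : Continuous (energy ε) := by
  unfold energy
  fun_prop

theorem tendsto_of_energy_tendsto_zero (hε : ∀ i, 0 < ε i) {α : Type*} {l : Filter α}
    {f : α → ι → ℝ} {s : ι → ℝ} (h : Tendsto (fun a => energy ε (f a - s)) l (𝓝 0)) :
    Tendsto f l (𝓝 s) := by
  rw [tendsto_pi_nhds]
  intro i
  rw [tendsto_iff_dist_tendsto_zero]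
  have h1 : Tendsto (fun a => √(ε i * energy ε (f a - s))) l (𝓝 0) := by
    simpa using (h.const_mul (ε i)).sqrt
  refine squeeze_zero (fun _ => dist_nonneg) (fun a => ?_) h1
  rw [Real.dist_eq]
  exact Real.abs_le_sqrt (sq_le_mul_energy hε (f a - s) i)

omit [Fintype ι] in
theorem IsProjEquilibrium.isProjSolution {z : ι → ℝ} (hz : IsProjEquilibrium J F z) :
    IsProjSolution ε J F fun _ => z := fun i => by
  simpa [hz.2 i] using CaratheodoryODE.const (z i)

namespace IsProjSolution

variable {x y : ℝ → ι → ℝ}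

omit [Fintype ι] in
theorem nonneg (hε : ∀ i, 0 < ε i) (hx : IsProjSolution ε J F x) (h0 : ∀ i ∈ J, 0 ≤ x 0 i)
    {t : ℝ} (ht : 0 ≤ t) : ∀ i ∈ J, 0 ≤ x t i := fun i hi =>
  (hx i).ge_of_rate_nonneg (h0 i hi) (fun s _ hs => by
    simp only [projField, hi, if_true]
    exact mul_nonneg (hε i).le (posProj_nonneg_of_nonpos hs.le)) ht

omit [Fintype ι] in
theorem continuousOn (hx : IsProjSolution ε J F x) : ContinuousOn x (Ici 0) :=
  continuousOn_pi.2 fun i => (hx i).continuousOn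

theorem energy_sub (hε : ∀ i, 0 < ε i) (hx : IsProjSolution ε J F x)
    (hy : IsProjSolution ε J F y) :
    CaratheodoryODE (fun t => energy ε (x t - y t)) (fun t => 2 *
      ∑ i, (projField J F (x t) i - projField J F (y t) i) * (x t i - y t i)) := by
  have h := CaratheodoryODE.sum Finset.univ fun i =>
    (((hx i).sub (hy i)).mul ((hx i).sub (hy i))).const_mul (1 / ε i)
  refine (h.congr_rate fun t _ => ?_).congr_fun fun t _ => ?_
  · rw [Finset.mul_sum]
    refine Finset.sum_congr rfl fun i _ => ?_
    have := (hε i).ne'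
    field_simp
    ring
  · refine Finset.sum_congr rfl fun i _ => ?_
    simp only [Pi.sub_apply]
    ring

end IsProjSolution

theorem projField_mul_le (J : Set ι) (F : (ι → ℝ) → ι → ℝ) {x y : ι → ℝ} (hx : ∀ i ∈ J, 0 ≤ x i)
    (hy : ∀ i ∈ J, 0 ≤ y i) :
    ∑ i, (projField J F x i - projField J F y i) * (x i - y i)
      ≤ ∑ i, (F x i - F y i) * (x i - y i) := by
  refine Finset.sum_le_sum fun i _ => ?_
  by_cases hi : i ∈ J
  · simp only [projField, hi, if_true]
    obtain ⟨k, hk, hkx, hk'⟩ := exists_posProj_eq_add (F x i) (hx i hi)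
    obtain ⟨l, hl, hly, hl'⟩ := exists_posProj_eq_add (F y i) (hy i hi)
    rw [hk', hl']
    nlinarith [mul_nonneg hk (hy i hi), mul_nonneg hl (hx i hi)]
  · simp [projField, hi]

/-- Two solutions of projected dissipative dynamics do not move apart. -/
theorem IsProjSolution.energy_sub_antitone (hε : ∀ i, 0 < ε i) (hF : Dissipative F)
    {x y : ℝ → ι → ℝ} (hx : IsProjSolution ε J F x) (hy : IsProjSolution ε J F y)
    (hx0 : ∀ i ∈ J, 0 ≤ x 0 i) (hy0 : ∀ i ∈ J, 0 ≤ y 0 i) {s t : ℝ} (hs : 0 ≤ s) (hst : s ≤ t) :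
    energy ε (x t - y t) ≤ energy ε (x s - y s) := by
  refine (hx.energy_sub hε hy).le_of_rate_nonpos (fun r hr => ?_) hs hst
  have h1 := projField_mul_le J F (hx.nonneg hε hx0 hr) (hy.nonneg hε hy0 hr)
  have h2 := hF (x r) (y r)
  linarith

/-- Along a solution that keeps its distance from an equilibrium `z`, nothing is dissipated, and the
projected coordinates stay complementary to the field at `z`. -/
theorem IsProjSolution.of_energy_const (hε : ∀ i, 0 < ε i) (hF : Dissipative F)
    (hFc : Continuous F) {y : ℝ → ι → ℝ} {z : ι → ℝ} (hy : IsProjSolution ε J F y)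
    (hz : IsProjEquilibrium J F z) (hy0 : ∀ i ∈ J, 0 ≤ y 0 i)
    (hconst : ∀ t, 0 ≤ t → energy ε (y t - z) = energy ε (y 0 - z)) {t : ℝ} (ht : 0 ≤ t) :
    ∑ i, (F (y t) i - F z i) * (y t i - z i) = 0 ∧ ∀ i ∈ J, F z i ≤ 0 ∧ F z i * y t i = 0 := by
  have hJ : ∀ i ∈ J, F z i ≤ 0 ∧ F z i * z i = 0 := fun i hi => by
    have := hz.2 i
    simp only [projField, hi, if_true] at this
    exact (posProj_eq_zero_iff (hz.1 i hi)).1 this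
  have hnJ : ∀ i ∉ J, F z i = 0 := fun i hi => by simpa [projField, hi] using hz.2 i
  -- the part of the dissipation that stems from the complementary pairs
  have hterm : ∀ s, 0 ≤ s → ∀ i, F z i * (y s i - z i) ≤ 0 := by
    intro s hs i
    by_cases hi : i ∈ J
    · have := mul_nonneg (neg_nonneg.2 (hJ i hi).1) (hy.nonneg hε hy0 hs i hi)
      linarith [(hJ i hi).2, mul_sub (F z i) (y s i) (z i)]
    · simp [hnJ i hi]
  have hsum : ∀ s, 0 ≤ s → ∑ i, F z i * (y s i - z i) ≤ 0 := fun s hs =>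
    Finset.sum_nonpos fun i _ => hterm s hs i
  have hsplit : ∀ s, ∑ i, F (y s) i * (y s i - z i)
      = ∑ i, (F (y s) i - F z i) * (y s i - z i) + ∑ i, F z i * (y s i - z i) := fun s => by
    rw [← Finset.sum_add_distrib]
    exact Finset.sum_congr rfl fun i _ => by ring
  have hcont : ContinuousOn (fun s => ∑ i, F (y s) i * (y s i - z i)) (Ici 0) := by
    refine continuousOn_finsetSum _ fun i _ => ?_
    have h1 := hy.continuousOn
    have h2 : ContinuousOn (fun s => F (y s) i) (Ici 0) :=
      ((continuous_apply i).comp hFc).comp_continuousOn h1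
    exact h2.mul ((hy i).continuousOn.sub continuousOn_const)
  have hzero := (hy.energy_sub hε hz.isProjSolution).rate_eq_zero_of_const hconst hcont
    (fun s hs h0 => by
      have h1 := projField_mul_le J F (x := y s) (y := z) (hy.nonneg hε hy0 hs) hz.1
      have h2 : ∑ i, projField J F (y s) i * (y s i - z i) = 0 := by
        have : ∀ i, projField J F z i = 0 := hz.2
        simpa [this] using h0
      have h3 : ∑ i, projField J F (y s) i * (y s i - z i) ≤ ∑ i, F (y s) i * (y s i - z i) := by
        refine Finset.sum_le_sum fun i _ => ?_
        by_cases hi : i ∈ J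
        · simp only [projField, hi, if_true]
          obtain ⟨k, hk, hky, hk'⟩ := exists_posProj_eq_add (F (y s) i) (hy.nonneg hε hy0 hs i hi)
          rw [hk']
          nlinarith [mul_nonneg hk (hz.1 i hi)]
        · simp [projField, hi]
      have h4 := hF (y s) z
      linarith [hsplit s, hsum s hs]) ht
  have h4 := hF (y t) z
  have h5 := hsum t ht
  have h6 : ∑ i, F z i * (y t i - z i) = 0 := by linarith [hsplit t]
  refine ⟨by linarith [hsplit t], fun i hi => ⟨(hJ i hi).1, ?_⟩⟩
  have h7 := (Finset.sum_eq_zero_iff_of_nonpos fun i _ => hterm t ht i).1 h6 i (Finset.mem_univ i)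
  linarith [(hJ i hi).2, mul_sub (F z i) (y t i) (z i)]

/-- LaSalle's principle for projected dissipative dynamics.  Limit points of a solution `x` start
solutions that keep their distance from `z`; if all those are equilibria, then the distance of `x`
from a limit point decreases, and hence tends to zero. -/
theorem IsProjSolution.exists_tendsto (hε : ∀ i, 0 < ε i) (hF : Dissipative F)
    (hex : ∀ x₀ : ι → ℝ, (∀ i ∈ J, 0 ≤ x₀ i) → ∃ x, IsProjSolution ε J F x ∧ x 0 = x₀)
    {z : ι → ℝ} (hz : IsProjEquilibrium J F z)
    (hinv : ∀ y, IsProjSolution ε J F y → (∀ i ∈ J, 0 ≤ y 0 i) →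
      (∀ t, 0 ≤ t → energy ε (y t - z) = energy ε (y 0 - z)) → IsProjEquilibrium J F (y 0))
    {x : ℝ → ι → ℝ} (hx : IsProjSolution ε J F x) (hx0 : ∀ i ∈ J, 0 ≤ x 0 i) :
    ∃ s, IsProjEquilibrium J F s ∧ Tendsto x atTop (𝓝 s) := by
  have hanti : ∀ {s t : ℝ}, 0 ≤ s → s ≤ t → energy ε (x t - z) ≤ energy ε (x s - z) :=
    fun hs hst => hx.energy_sub_antitone hε hF hz.isProjSolution hx0 hz.1 hs hst
  -- the orbit is bounded
  set R := ∑ i, (|z i| + √(ε i * energy ε (x 0 - z))) with hR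
  have hbd : ∀ n : ℕ, x n ∈ Metric.closedBall (0 : ι → ℝ) R := by
    intro n
    rw [mem_closedBall_zero_iff, pi_norm_le_iff_of_nonneg (by positivity)]
    intro i
    have h1 : |(x n - z) i| ≤ √(ε i * energy ε (x 0 - z)) := by
      refine Real.abs_le_sqrt ((sq_le_mul_energy hε _ i).trans ?_)
      exact mul_le_mul_of_nonneg_left (hanti le_rfl (Nat.cast_nonneg n)) (hε i).le
    have h2 : |x n i| ≤ |z i| + √(ε i * energy ε (x 0 - z)) := by
      have h3 := abs_add_le (z i) ((x n - z) i)
      simp only [Pi.sub_apply, add_sub_cancel] at h3 h1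
      linarith
    exact h2.trans (Finset.single_le_sum (f := fun i => |z i| + √(ε i * energy ε (x 0 - z)))
      (fun i _ => by positivity) (Finset.mem_univ i))
  obtain ⟨s, -, φ, hφ, hlim⟩ := (isCompact_closedBall (0 : ι → ℝ) R).tendsto_subseq hbd
  have hs0 : ∀ i ∈ J, 0 ≤ s i := fun i hi =>
    ge_of_tendsto' ((continuous_apply i).continuousAt.tendsto.comp hlim)
      fun n => hx.nonneg hε hx0 (Nat.cast_nonneg _) i hi
  obtain ⟨y, hy, rfl⟩ := hex s hs0
  have hφt : Tendsto (fun n => ((φ n : ℕ) : ℝ)) atTop atTop :=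
    tendsto_natCast_atTop_atTop.comp hφ.tendsto_atTop
  -- by nonexpansiveness the translates of `x` converge to `y` at all times
  have hshift : ∀ a : ℝ, 0 ≤ a → IsProjSolution ε J F fun t => x (a + t) :=
    fun a ha i => (hx i).comp_const_add ha
  have htrans : ∀ t, 0 ≤ t → Tendsto (fun n => x (φ n + t)) atTop (𝓝 (y t)) := by
    intro t ht
    have h0 : Tendsto (fun n => energy ε (x (φ n) - y 0)) atTop (𝓝 0) := by
      have : Tendsto (fun n => energy ε (x (φ n) - y 0)) atTop (𝓝 (energy ε (y 0 - y 0))) :=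
        (continuous_energy.tendsto _).comp (hlim.sub tendsto_const_nhds)
      simpa [energy] using this
    have hle : ∀ n, energy ε (x (φ n + t) - y t) ≤ energy ε (x (φ n) - y 0) := fun n => by
      have h := (hshift (φ n) (Nat.cast_nonneg _)).energy_sub_antitone hε hF hy
        (by simpa using hx.nonneg hε hx0 (Nat.cast_nonneg (φ n))) hs0 le_rfl ht
      simpa using h
    exact tendsto_of_energy_tendsto_zero hε (squeeze_zero (fun _ => energy_nonneg hε _) hle h0)
  -- the distance of `x` from `z` converges, so `y` keeps its distance
  have hVlim : ∃ l, Tendsto (fun t => energy ε (x (max t 0) - z)) atTop (𝓝 l) := by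
    refine ⟨_, tendsto_atTop_ciInf ?_ ⟨0, ?_⟩⟩
    · intro s t hst
      exact hanti (le_max_right _ _) (max_le_max hst le_rfl)
    · rintro _ ⟨t, rfl⟩
      exact energy_nonneg hε _
  obtain ⟨l, hl⟩ := hVlim
  have hVy : ∀ t, 0 ≤ t → energy ε (y t - z) = l := by
    intro t ht
    have h1 : Tendsto (fun n => energy ε (x (φ n + t) - z)) atTop (𝓝 (energy ε (y t - z))) :=
      (continuous_energy.tendsto _).comp ((htrans t ht).sub tendsto_const_nhds)
    have h2 := hl.comp (tendsto_atTop_add_const_right atTop t hφt)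
    refine tendsto_nhds_unique h1 (h2.congr fun n => ?_)
    simp only [Function.comp]
    rw [max_eq_left (by positivity)]
  have heq : IsProjEquilibrium J F (y 0) :=
    hinv y hy hs0 fun t ht => by rw [hVy t ht, hVy 0 le_rfl]
  refine ⟨y 0, heq, ?_⟩
  have h0 : Tendsto (fun n => energy ε (x (φ n) - y 0)) atTop (𝓝 0) := by
    have : Tendsto (fun n => energy ε (x (φ n) - y 0)) atTop (𝓝 (energy ε (y 0 - y 0))) :=
      (continuous_energy.tendsto _).comp (hlim.sub tendsto_const_nhds)
    simpa [energy] using this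
  have hE : Tendsto (fun t => energy ε (x t - y 0)) atTop (𝓝 0) := by
    rw [Metric.tendsto_atTop]
    intro e he
    obtain ⟨n, hn⟩ := ((tendsto_order.1 h0).2 e he).exists
    refine ⟨φ n, fun t ht => ?_⟩
    rw [Real.dist_eq, sub_zero, abs_of_nonneg (energy_nonneg hε _)]
    exact (hx.energy_sub_antitone hε hF heq.isProjSolution hx0 hs0 (Nat.cast_nonneg _)
      ht).trans_lt hn
  exact tendsto_of_energy_tendsto_zero hε hE

end

/-! ### Existence for smooth dissipative fields -/

section

variable {ι : Type*} [Fintype ι] {ε : ι → ℝ} {J : Set ι} {F : (ι → ℝ) → ι → ℝ}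

theorem hasDerivAt_energy (hε : ∀ i, 0 < ε i) {x : ℝ → ι → ℝ} {v : ι → ℝ} {t : ℝ}
    (h : ∀ i, HasDerivAt (fun s => x s i) (ε i * v i) t) :
    HasDerivAt (fun s => energy ε (x s)) (2 * ∑ i, v i * x t i) t := by
  have h1 := HasDerivAt.fun_sum (u := Finset.univ) fun i _ => ((h i).pow 2).div_const (ε i)
  refine h1.congr_deriv ?_
  rw [Finset.mul_sum]
  refine Finset.sum_congr rfl fun i _ => ?_
  have := (hε i).ne'
  field_simp
  ring

/-- A continuously differentiable field that is dissipative with respect to a point `z` has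
solutions on any bounded interval.  Multiplying the field by a cut-off function keeps it dissipative
with respect to `z`, so the solution never reaches the region where the field was changed. -/
theorem exists_solution_of_contDiff (hε : ∀ i, 0 < ε i) {f : (ι → ℝ) → ι → ℝ} (hf : ContDiff ℝ 1 f)
    {z : ι → ℝ} (hdiss : ∀ x, ∑ i, f x i * (x i - z i) ≤ 0) (x₀ : ι → ℝ) (T : ℝ) (hT : 0 ≤ T) :
    ∃ x : ℝ → ι → ℝ, x 0 = x₀ ∧
      (∀ t ∈ Icc 0 T, ∀ i, HasDerivAt (fun s => x s i) (ε i * f (x t) i) t) ∧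
      ∀ t ∈ Icc 0 T, energy ε (x t - z) ≤ energy ε (x₀ - z) := by
  classical
  set R := ∑ i, √(ε i * energy ε (x₀ - z)) with hR
  have hR0 : 0 ≤ R := Finset.sum_nonneg fun i _ => Real.sqrt_nonneg _
  let χ : ContDiffBump z := ⟨R + 1, R + 2, by linarith, by linarith⟩
  set g : (ι → ℝ) → ι → ℝ := fun x => χ x • fun i => ε i * f x i with hg
  have hgC : ContDiff ℝ 1 g := by
    refine χ.contDiff.smul ?_
    exact contDiff_pi.2 fun i => contDiff_const.mul (contDiff_pi.1 hf i)
  have hsupp : HasCompactSupport g := χ.hasCompactSupport.smul_right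
  obtain ⟨K, hK⟩ := ContDiff.lipschitzWith_of_hasCompactSupport hsupp hgC one_ne_zero
  obtain ⟨B, hB⟩ := hsupp.exists_bound_of_continuous hgC.continuous
  set B' : NNReal := ⟨max B 0, le_max_right _ _⟩ with hB'
  have hmem : (0 : ℝ) ∈ Icc (-1) (T + 1) := ⟨by norm_num, by linarith⟩
  have hPL : IsPicardLindelof (fun _ => g) (⟨0, hmem⟩ : Icc (-1 : ℝ) (T + 1)) x₀
      (B' * ⟨T + 1, by linarith⟩) 0 B' K := by
    refine IsPicardLindelof.of_time_independent (fun x _ => (hB x).trans (le_max_left _ _))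
      hK.lipschitzOnWith ?_
    simp only [sub_zero, zero_sub, neg_neg, NNReal.coe_zero]
    rw [max_eq_left (by linarith)]
    exact le_rfl
  obtain ⟨x, hx0, hx⟩ := hPL.exists_eq_forall_mem_Icc_hasDerivWithinAt₀
  have hx' : ∀ t ∈ Icc 0 T, ∀ i, HasDerivAt (fun s => x s i) (ε i * (χ (x t) * f (x t) i)) t := by
    intro t ht i
    have h1 := (hx t ⟨by linarith [ht.1], by linarith [ht.2]⟩).hasDerivAt
      (Icc_mem_nhds (by linarith [ht.1]) (by linarith [ht.2]))
    have h2 := hasDerivAt_pi.1 h1 i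
    refine h2.congr_deriv ?_
    simp only [hg, Pi.smul_apply, smul_eq_mul]
    ring
  have hder : ∀ t ∈ Icc 0 T, HasDerivAt (fun s => energy ε (x s - z))
      (2 * ∑ i, χ (x t) * f (x t) i * (x t i - z i)) t := fun t ht =>
    hasDerivAt_energy hε (x := fun s => x s - z) fun i => by
      simpa using (hx' t ht i).sub_const (z i)
  have hle : ∀ t ∈ Icc 0 T, energy ε (x t - z) ≤ energy ε (x₀ - z) := by
    have hanti : AntitoneOn (fun s => energy ε (x s - z)) (Icc 0 T) := by
      refine antitoneOn_of_deriv_nonpos (convex_Icc 0 T)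
        (fun t ht => (hder t ht).continuousAt.continuousWithinAt)
        (fun t ht => (hder t (interior_subset ht)).differentiableAt.differentiableWithinAt)
        fun t ht => ?_
      rw [(hder t (interior_subset ht)).deriv]
      simp only [mul_assoc, ← Finset.mul_sum]
      have := mul_nonpos_of_nonneg_of_nonpos (χ.nonneg' (x t)) (hdiss (x t))
      linarith
    intro t ht
    have := hanti ⟨le_rfl, hT⟩ ht ht.1
    simpa [hx0] using this
  refine ⟨x, hx0, fun t ht i => ?_, hle⟩
  have hone : χ (x t) = 1 := by
    refine χ.one_of_mem_closedBall ?_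
    rw [mem_closedBall_iff_norm]
    change ‖x t - z‖ ≤ R + 1
    refine le_trans ?_ (le_add_of_nonneg_right zero_le_one)
    rw [pi_norm_le_iff_of_nonneg hR0]
    intro i
    have h1 : |(x t - z) i| ≤ √(ε i * energy ε (x₀ - z)) := Real.abs_le_sqrt
      ((sq_le_mul_energy hε _ i).trans (mul_le_mul_of_nonneg_left (hle t ht) (hε i).le))
    exact h1.trans (Finset.single_le_sum (f := fun i => √(ε i * energy ε (x₀ - z)))
      (fun i _ => Real.sqrt_nonneg _) (Finset.mem_univ i))
  simpa [hone] using hx' t ht i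

end

/-! ### Smooth approximation of monotone fields and of the projection -/

/-- Steklov averages `(Φ(s + h) - Φ(s)) / h` approximate a continuous monotone `Φ'` by functions
that are monotone and continuously differentiable; a shift makes them exact at `z`. -/
theorem exists_contDiff_monotone_approx {Φ : ℝ → ℝ} (hΦ : ContDiff ℝ 1 Φ)
    (hmono : Monotone (deriv Φ)) (z ρ : ℝ) {δ : ℝ} (hδ : 0 < δ) :
    ∃ ψ : ℝ → ℝ, ContDiff ℝ 1 ψ ∧ Monotone ψ ∧ ψ z = deriv Φ z ∧
      ∀ s, |s| ≤ ρ → |ψ s - deriv Φ s| ≤ δ := by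
  have hc : Continuous (deriv Φ) := hΦ.continuous_deriv_one
  have hdiff : Differentiable ℝ Φ := hΦ.differentiable one_ne_zero
  set ρ' := max ρ |z| with hρ'
  have huc := (isCompact_Icc (a := -ρ') (b := ρ' + 1)).uniformContinuousOn_of_continuous
    hc.continuousOn
  rw [Metric.uniformContinuousOn_iff] at huc
  obtain ⟨η, hη, H⟩ := huc (δ / 2) (by linarith)
  set h := min (η / 2) 1 with hh
  have hh0 : 0 < h := lt_min (by linarith) one_pos
  have hhη : h < η := (min_le_left _ _).trans_lt (by linarith)
  have hh1 : h ≤ 1 := min_le_right _ _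
  set A : ℝ → ℝ := fun s => (Φ (s + h) - Φ s) / h with hA
  have hAC : ContDiff ℝ 1 A :=
    ((hΦ.comp (contDiff_id.add contDiff_const)).sub hΦ).div_const h
  have hAm : Monotone A := by
    refine monotone_of_deriv_nonneg (hAC.differentiable one_ne_zero) fun s => ?_
    have hd : HasDerivAt A ((deriv Φ (s + h) - deriv Φ s) / h) s :=
      (((hdiff (s + h)).hasDerivAt.comp_add_const s h).sub (hdiff s).hasDerivAt).div_const h
    rw [hd.deriv]
    exact div_nonneg (sub_nonneg.2 (hmono (by linarith))) hh0.le
  have hAe : ∀ s, |s| ≤ ρ' → |A s - deriv Φ s| ≤ δ / 2 := by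
    intro s hs
    rw [abs_le] at hs
    obtain ⟨c, hc1, hc2⟩ := exists_deriv_eq_slope Φ (lt_add_of_pos_right s hh0)
      hΦ.continuous.continuousOn hdiff.differentiableOn
    have hAs : A s = deriv Φ c := by rw [hc2, hA]; simp
    rw [hAs, ← Real.dist_eq]
    refine (H c ⟨by linarith [hc1.1, hs.1], by linarith [hc1.2, hs.2]⟩ s
      ⟨by linarith, by linarith⟩ ?_).le
    rw [Real.dist_eq, abs_lt]
    exact ⟨by linarith [hc1.1], by linarith [hc1.2]⟩
  refine ⟨fun s => A s - A z + deriv Φ z, (hAC.sub contDiff_const).add contDiff_const,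
    fun a b hab => by simpa using hAm hab, by simp, fun s hs => ?_⟩
  have h1 := abs_le.1 (hAe s (hs.trans (le_max_left _ _)))
  have h2 := abs_le.1 (hAe z (le_max_right _ _))
  rw [abs_le]
  exact ⟨by linarith, by linarith⟩

/-- A continuously differentiable substitute for the reaction force that keeps a coordinate
nonnegative: it is as large as `C` below `-β`, and it vanishes above `β`.  The prescribed value `k`
at `0` makes it possible to preserve a given equilibrium exactly. -/
theorem exists_penalty {C β k : ℝ} (hC : 0 < C) (hβ : 0 < β) (hk : 0 ≤ k) (hkC : k ≤ C) :
    ∃ q : ℝ → ℝ, ContDiff ℝ 1 q ∧ Antitone q ∧ q 0 = k ∧ (∀ s, 0 ≤ q s) ∧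
      (k = 0 → ∀ s, 0 ≤ s → q s = 0) ∧ (∀ s, β ≤ s → q s = 0) ∧ (∀ s, s ≤ -β → C ≤ q s) ∧
      ∀ s, -β ≤ s → q s ≤ 4 * C := by
  -- `p s = s² - s|s|` is `2 s²` for negative `s` and vanishes otherwise
  set p : ℝ → ℝ := fun s => s ^ 2 - s * |s| with hp
  have hpd : ∀ s, HasDerivAt p (2 * s - 2 * |s|) s := by
    intro s
    refine (by simpa using hasDerivAt_pow 2 s : HasDerivAt (fun s : ℝ => s ^ 2) (2 * s) s).sub ?_
    rcases lt_trichotomy s 0 with hs | rfl | hs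
    · have h := (hasDerivAt_id s).mul (hasDerivAt_abs_neg hs)
      refine h.congr_deriv ?_
      simp only [id, abs_of_neg hs]
      ring
    · rw [hasDerivAt_iff_tendsto_slope]
      have : Tendsto (fun s : ℝ => |s|) (𝓝[≠] 0) (𝓝 (2 * |0|)) := by
        have := (continuous_abs.tendsto (0 : ℝ)).mono_left (nhdsWithin_le_nhds (s := {0}ᶜ))
        simpa using this
      refine this.congr' ?_
      filter_upwards [self_mem_nhdsWithin] with s hs
      have : s ≠ 0 := hs
      simp [slope_def_field]
      field_simp
    · have h := (hasDerivAt_id s).mul (hasDerivAt_abs_pos hs)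
      refine h.congr_deriv ?_
      simp only [id, abs_of_pos hs]
      ring
  have hpC : ContDiff ℝ 1 p := by
    rw [contDiff_one_iff_deriv]
    refine ⟨fun s => (hpd s).differentiableAt, ?_⟩
    rw [funext fun s => (hpd s).deriv]
    fun_prop
  have hpa : Antitone p := antitone_of_deriv_nonpos (fun s => (hpd s).differentiableAt) fun s => by
    rw [(hpd s).deriv]
    linarith [le_abs_self s]
  have hpos : ∀ s, 0 ≤ s → p s = 0 := fun s hs => by simp [hp, abs_of_nonneg hs]; ring
  have hneg : ∀ s, s ≤ 0 → p s = 2 * s ^ 2 := fun s hs => by simp [hp, abs_of_nonpos hs]; ring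
  have hp0 : ∀ s, 0 ≤ p s := fun s => by
    rcases le_total 0 s with hs | hs
    · rw [hpos s hs]
    · rw [hneg s hs]; positivity
  set b := β * √(k / C) with hb
  have hb0 : 0 ≤ b := by positivity
  have hbβ : b ≤ β := by
    refine mul_le_of_le_one_right hβ.le ?_
    rw [Real.sqrt_le_iff]
    exact ⟨zero_le_one, by simpa using (div_le_one hC).2 hkC⟩
  have hqa : Antitone fun s => C / (2 * β ^ 2) * p (s - b) := fun s t hst =>
    mul_le_mul_of_nonneg_left (hpa (by linarith)) (by positivity)
  refine ⟨fun s => C / (2 * β ^ 2) * p (s - b),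
    contDiff_const.mul (hpC.comp (contDiff_id.sub contDiff_const)), hqa, ?_,
    fun s => mul_nonneg (by positivity) (hp0 _), ?_, ?_, ?_, ?_⟩
  · simp only [zero_sub]
    rw [hneg _ (by linarith), neg_sq, hb, mul_pow, Real.sq_sqrt (by positivity)]
    field_simp
  · intro hk0 s hs
    have : b = 0 := by simp [hb, hk0]
    simp only [hpos (s - b) (by linarith), mul_zero]
  · intro s hs
    simp only [hpos (s - b) (by linarith), mul_zero]
  · intro s hs
    refine le_trans ?_ (hqa hs)
    change C ≤ C / (2 * β ^ 2) * p (-β - b)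
    rw [hneg _ (by linarith)]
    have : β ^ 2 ≤ (-β - b) ^ 2 := by nlinarith
    calc C = C / (2 * β ^ 2) * (2 * β ^ 2) := by field_simp
      _ ≤ _ := by gcongr
  · intro s hs
    refine (hqa hs).trans ?_
    change C / (2 * β ^ 2) * p (-β - b) ≤ _
    rw [hneg _ (by linarith)]
    have : (-β - b) ^ 2 ≤ 4 * β ^ 2 := by nlinarith
    calc _ ≤ C / (2 * β ^ 2) * (2 * (4 * β ^ 2)) := by gcongr
      _ = 4 * C := by field_simp

/-! ### Existence for projected monotone dynamics -/

/-- Lower bounds on derivatives pass to the derivative of a limit. -/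
theorem le_of_eventually_le_deriv {u v : ℕ → ℝ → ℝ} {X : ℝ → ℝ} {t₀ a D : ℝ}
    (hlim : ∀ᶠ t in 𝓝 t₀, Tendsto (fun n => u n t) atTop (𝓝 (X t)))
    (hd : ∀ᶠ p in (atTop : Filter ℕ) ×ˢ 𝓝 t₀,
      HasDerivAt (u p.1) (v p.1 p.2) p.2 ∧ a ≤ v p.1 p.2)
    (hX : HasDerivAt X D t₀) : a ≤ D := by
  rw [eventually_prod_iff] at hd
  obtain ⟨P, hP, Q, hQ, H⟩ := hd
  obtain ⟨δ, hδ, hball⟩ := Metric.eventually_nhds_iff_ball.1 (hlim.and hQ)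
  have hinc : ∀ t, t₀ < t → t < t₀ + δ → a * (t - t₀) ≤ X t - X t₀ := by
    intro t h1 h2
    have hmem : ∀ s ∈ Icc t₀ t, s ∈ Metric.ball t₀ δ := fun s hs => by
      rw [Metric.mem_ball, Real.dist_eq, abs_lt]
      exact ⟨by linarith [hs.1], by linarith [hs.2]⟩
    refine ge_of_tendsto ((hball t (hmem t ⟨h1.le, le_rfl⟩)).1.sub
      (hball t₀ (hmem t₀ ⟨le_rfl, h1.le⟩)).1) ?_
    filter_upwards [hP] with n hn
    have hder : ∀ s ∈ Icc t₀ t, HasDerivAt (u n) (v n s) s ∧ a ≤ v n s := fun s hs =>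
      H hn (hball s (hmem s hs)).2
    refine (convex_Icc t₀ t).mul_sub_le_image_sub_of_le_deriv
      (fun s hs => (hder s hs).1.continuousAt.continuousWithinAt)
      (fun s hs => (hder s (interior_subset hs)).1.differentiableAt.differentiableWithinAt)
      (fun s hs => ?_) t₀ ⟨le_rfl, h1.le⟩ t ⟨h1.le, le_rfl⟩ h1.le
    rw [(hder s (interior_subset hs)).1.deriv]
    exact (hder s (interior_subset hs)).2
  have hs := hX.tendsto_slope.mono_left (nhdsWithin_mono t₀ (fun t (ht : t₀ < t) => ht.ne') :
    𝓝[>] t₀ ≤ 𝓝[≠] t₀)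
  refine ge_of_tendsto hs ?_
  filter_upwards [Ioo_mem_nhdsGT (lt_add_of_pos_right t₀ hδ)] with t ht
  rw [slope_def_field, le_div_iff₀ (by linarith [ht.1])]
  exact hinc t ht.1 ht.2

section

variable {ι : Type*} [Fintype ι] {ε : ι → ℝ} {J : Set ι} {F : (ι → ℝ) → ι → ℝ}

/-- A sequence of curves `x n` on `[0, n]` that solve the projected dynamics up to errors `e n` and
with smooth reaction forces `q n` in place of the projection. -/
structure IsApproximation (ε : ι → ℝ) (J : Set ι) (F : (ι → ℝ) → ι → ℝ) (x₀ : ι → ℝ) (C : ℝ)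
    (x e q : ℕ → ℝ → ι → ℝ) : Prop where
  init : ∀ n, x n 0 = x₀
  hasDerivAt : ∀ n : ℕ, ∀ t ∈ Icc (0 : ℝ) n, ∀ i,
    HasDerivAt (fun s => x n s i) (ε i * (F (x n t) i + e n t i + q n t i)) t
  abs_apply_le : ∀ n : ℕ, ∀ t ∈ Icc (0 : ℝ) n, ∀ i, |x n t i| ≤ C
  abs_field_le : ∀ n : ℕ, ∀ t ∈ Icc (0 : ℝ) n, ∀ i, |F (x n t) i| ≤ C
  error_le : ∀ n : ℕ, ∀ t ∈ Icc (0 : ℝ) n, ∀ i, |e n t i| ≤ 1 / ((n : ℝ) + 1)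
  force_nonneg : ∀ n : ℕ, ∀ t ∈ Icc (0 : ℝ) n, ∀ i, 0 ≤ q n t i
  force_le : ∀ n : ℕ, ∀ t ∈ Icc (0 : ℝ) n, ∀ i, q n t i ≤ C
  force_eq_zero : ∀ (n : ℕ) t i, i ∉ J → q n t i = 0
  force_eq_zero_of_ge : ∀ (n : ℕ) t i, 1 / ((n : ℝ) + 1) ≤ x n t i → q n t i = 0
  ge_neg : ∀ n : ℕ, ∀ t ∈ Icc (0 : ℝ) n, ∀ i ∈ J, -(1 / ((n : ℝ) + 1)) ≤ x n t i

/-- Approximations on arbitrarily long intervals exist because the smoothed field keeps the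
equilibrium `z`, the distance to which bounds the curves uniformly. -/
theorem exists_isApproximation (hε : ∀ i, 0 < ε i) {Φ : ι → ℝ → ℝ} {L : (ι → ℝ) → ι → ℝ}
    (hΦ : ∀ i, ContDiff ℝ 1 (Φ i)) (hmono : ∀ i, Monotone (deriv (Φ i))) (hL : ContDiff ℝ 1 L)
    (hdL : Dissipative L) (hF : ∀ x i, F x i = -deriv (Φ i) (x i) + L x i) {z : ι → ℝ}
    (hz : IsProjEquilibrium J F z) {x₀ : ι → ℝ} (hx₀ : ∀ i ∈ J, 0 ≤ x₀ i) :
    ∃ C, 0 < C ∧ ∃ x e q, IsApproximation ε J F x₀ C x e q := by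
  classical
  have hFc : Continuous F := by
    refine continuous_pi fun i => ?_
    simp_rw [hF]
    exact (((hΦ i).continuous_deriv_one.comp (continuous_apply i)).neg).add
      (continuous_pi_iff.1 hL.continuous i)
  have hJ : ∀ i ∈ J, F z i ≤ 0 ∧ F z i * z i = 0 := fun i hi => by
    have := hz.2 i
    simp only [projField, hi, if_true] at this
    exact (posProj_eq_zero_iff (hz.1 i hi)).1 this
  have hnJ : ∀ i ∉ J, F z i = 0 := fun i hi => by simpa [projField, hi] using hz.2 i
  set ρ := ∑ i, (|z i| + √(ε i * energy ε (x₀ - z))) with hρ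
  have hball : ∀ y : ι → ℝ, energy ε (y - z) ≤ energy ε (x₀ - z) → ∀ i, |y i| ≤ ρ := by
    intro y hy i
    have h1 : |(y - z) i| ≤ √(ε i * energy ε (x₀ - z)) := Real.abs_le_sqrt
      ((sq_le_mul_energy hε _ i).trans (mul_le_mul_of_nonneg_left hy (hε i).le))
    have h2 : |y i| ≤ |z i| + √(ε i * energy ε (x₀ - z)) := by
      have h3 := abs_add_le (z i) ((y - z) i)
      simp only [Pi.sub_apply, add_sub_cancel] at h3 h1
      linarith
    exact h2.trans (Finset.single_le_sum (f := fun i => |z i| + √(ε i * energy ε (x₀ - z)))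
      (fun i _ => by positivity) (Finset.mem_univ i))
  have hρ0 : 0 ≤ ρ := Finset.sum_nonneg fun i _ => by positivity
  obtain ⟨M, hM⟩ := (isCompact_closedBall (0 : ι → ℝ) ρ).exists_bound_of_continuousOn
    hFc.continuousOn
  have hMb : ∀ y : ι → ℝ, energy ε (y - z) ≤ energy ε (x₀ - z) → ∀ i, |F y i| ≤ M := by
    intro y hy i
    refine (norm_le_pi_norm (F y) i).trans (hM y ?_)
    rw [mem_closedBall_zero_iff, pi_norm_le_iff_of_nonneg hρ0]
    exact hball y hy
  have hM0 : 0 ≤ M := (norm_nonneg _).trans (hM 0 (by simpa using hρ0))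
  set C := max M ρ + 1 with hC
  have hCM : M + 1 ≤ C := by rw [hC]; linarith [le_max_left M ρ]
  have hCρ : ρ ≤ C := by rw [hC]; linarith [le_max_right M ρ]
  have hC0 : 0 < C := by linarith
  have hzM : ∀ i, |F z i| ≤ M := hMb z (by simpa [energy] using energy_nonneg hε (x₀ - z))
  have hδ : ∀ n : ℕ, (0 : ℝ) < 1 / ((n : ℝ) + 1) := fun n => by positivity
  have hδ1 : ∀ n : ℕ, 1 / ((n : ℝ) + 1) ≤ 1 := fun n => by
    rw [div_le_one (by positivity)]; linarith [(Nat.cast_nonneg n : (0 : ℝ) ≤ n)]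
  choose ψ hψC hψm hψz hψe using fun (n : ℕ) (i : ι) =>
    exists_contDiff_monotone_approx (hΦ i) (hmono i) (z i) ρ (hδ n)
  have hpen : ∀ (n : ℕ) (i : ι), ∃ q : ℝ → ℝ, ContDiff ℝ 1 q ∧ Antitone q ∧ q (z i) = -F z i ∧
      (∀ s, 0 ≤ q s) ∧ (i ∉ J → ∀ s, q s = 0) ∧ (∀ s, 1 / ((n : ℝ) + 1) ≤ s → q s = 0) ∧
      (i ∈ J → ∀ s, s ≤ -(1 / ((n : ℝ) + 1)) → C ≤ q s) ∧
      ∀ s, -(1 / ((n : ℝ) + 1)) ≤ s → q s ≤ 4 * C := by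
    intro n i
    by_cases hi : i ∈ J
    · obtain ⟨q, h1, h2, h3, h4, h5, h6, h7, h8⟩ := exists_penalty hC0 (hδ n)
        (neg_nonneg.2 (hJ i hi).1) (by linarith [(abs_le.1 (hzM i)).1])
      refine ⟨q, h1, h2, ?_, h4, fun h => absurd hi h, h6, fun _ => h7, h8⟩
      rcases mul_eq_zero.1 (hJ i hi).2 with h | h
      · rw [h5 (by rw [h, neg_zero]) _ (hz.1 i hi), h, neg_zero]
      · rw [h, h3]
    · exact ⟨fun _ => 0, contDiff_const, antitone_const, by simp [hnJ i hi], fun _ => le_rfl,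
        fun _ _ => rfl, fun _ _ => rfl, fun h => absurd h hi, fun _ _ => by positivity⟩
  choose q hqC hqa hqz hq0 hqJ hqge hqle hq4 using hpen
  -- the smoothed field still has the equilibrium `z`
  have hflow : ∀ n : ℕ, ∃ x : ℝ → ι → ℝ, x 0 = x₀ ∧
      (∀ t ∈ Icc (0 : ℝ) n, ∀ i, HasDerivAt (fun s => x s i)
        (ε i * (-ψ n i (x t i) + L (x t) i + q n i (x t i))) t) ∧
      ∀ t ∈ Icc (0 : ℝ) n, energy ε (x t - z) ≤ energy ε (x₀ - z) := by
    intro n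
    refine exists_solution_of_contDiff hε
      (f := fun x i => -ψ n i (x i) + L x i + q n i (x i)) ?_ ?_ x₀ n (Nat.cast_nonneg n)
    · refine contDiff_pi.2 fun i => ((ContDiff.neg ?_).add (contDiff_pi.1 hL i)).add ?_
      · exact (hψC n i).comp (contDiff_apply ℝ ℝ i)
      · exact (hqC n i).comp (contDiff_apply ℝ ℝ i)
    · intro x
      refine le_trans (Finset.sum_le_sum fun i _ => ?_) (hdL x z)
      have hz' : -ψ n i (z i) + L z i + q n i (z i) = 0 := by
        rw [hqz, hF, hψz]; ring
      have h1 : 0 ≤ (ψ n i (x i) - ψ n i (z i)) * (x i - z i) := by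
        rcases le_total (x i) (z i) with h | h
        · exact mul_nonneg_of_nonpos_of_nonpos (sub_nonpos.2 (hψm n i h)) (sub_nonpos.2 h)
        · exact mul_nonneg (sub_nonneg.2 (hψm n i h)) (sub_nonneg.2 h)
      have h2 : (q n i (x i) - q n i (z i)) * (x i - z i) ≤ 0 := by
        rcases le_total (x i) (z i) with h | h
        · exact mul_nonpos_of_nonneg_of_nonpos (sub_nonneg.2 (hqa n i h)) (sub_nonpos.2 h)
        · exact mul_nonpos_of_nonpos_of_nonneg (sub_nonpos.2 (hqa n i h)) (sub_nonneg.2 h)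
      have h3 : (-ψ n i (x i) + L x i + q n i (x i)) * (x i - z i)
          = (L x i - L z i) * (x i - z i) - (ψ n i (x i) - ψ n i (z i)) * (x i - z i)
            + (q n i (x i) - q n i (z i)) * (x i - z i)
            + (-ψ n i (z i) + L z i + q n i (z i)) * (x i - z i) := by ring
      rw [h3, hz']
      linarith
  choose x hx0 hxd hxe using hflow
  have hψF : ∀ n : ℕ, ∀ t ∈ Icc (0 : ℝ) n, ∀ i,
      |deriv (Φ i) (x n t i) - ψ n i (x n t i)| ≤ 1 / ((n : ℝ) + 1) := fun n t ht i => by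
    rw [abs_sub_comm]
    exact hψe n i _ (hball _ (hxe n t ht) i)
  have hge : ∀ n : ℕ, ∀ t ∈ Icc (0 : ℝ) n, ∀ i ∈ J, -(1 / ((n : ℝ) + 1)) ≤ x n t i := by
    intro n t ht i hi
    have hcont : ContinuousOn (fun s => x n s i) (Icc (0 : ℝ) n) := fun s hs =>
      (hxd n s hs i).continuousAt.continuousWithinAt
    refine ge_of_le_while_below (f := fun s => x n s i) hcont ?_ (fun r s hr hrs hsn hlt => ?_) ht
    · simp only [hx0]
      linarith [hx₀ i hi, hδ n]
    · have hsub : Icc r s ⊆ Icc (0 : ℝ) n := Icc_subset_Icc hr hsn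
      refine (monotoneOn_of_deriv_nonneg (convex_Icc r s) (hcont.mono hsub)
        (fun a ha => (hxd n a (hsub (interior_subset ha)) i).differentiableAt.differentiableWithinAt)
        fun a ha => ?_) ⟨le_rfl, hrs⟩ ⟨hrs, le_rfl⟩ hrs
      have ha' := hsub (interior_subset ha)
      rw [interior_Icc] at ha
      rw [(hxd n a ha' i).deriv]
      refine mul_nonneg (hε i).le ?_
      have h1 := hqle n i hi _ (hlt a ha).le
      have h2 := abs_le.1 (hMb _ (hxe n a ha') i)
      have h3 := abs_le.1 (hψF n a ha' i)
      rw [hF] at h2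
      linarith [hδ1 n]
  refine ⟨4 * C, by linarith, x, fun n t i => deriv (Φ i) (x n t i) - ψ n i (x n t i),
    fun n t i => q n i (x n t i), hx0, fun n t ht i => ?_, fun n t ht i => ?_, fun n t ht i => ?_,
    hψF, fun n t _ i => hq0 n i _, fun n t ht i => ?_, fun n t i hi => hqJ n i hi _,
    fun n t i h => hqge n i _ h, hge⟩
  · refine (hxd n t ht i).congr_deriv ?_
    rw [hF]
    ring
  · linarith [hball _ (hxe n t ht) i]
  · linarith [hMb _ (hxe n t ht) i]
  · by_cases hi : i ∈ J
    · exact hq4 n i _ (hge n t ht i hi)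
    · simp only [hqJ n i hi]
      linarith

namespace IsApproximation

variable {x₀ : ι → ℝ} {C : ℝ} {x e q : ℕ → ℝ → ι → ℝ}

/-- By monotonicity, the approximations form a Cauchy sequence. -/
theorem energy_sub_le (hε : ∀ i, 0 < ε i) (hF : Dissipative F) (hC : 0 < C)
    (h : IsApproximation ε J F x₀ C x e q) {n m : ℕ} {t : ℝ} (ht : 0 ≤ t) (hn : t ≤ n)
    (hm : t ≤ m) : energy ε (x n t - x m t) ≤
      8 * C * Fintype.card ι * (1 / ((n : ℝ) + 1) + 1 / ((m : ℝ) + 1)) * t := by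
  set δ := 1 / ((n : ℝ) + 1) + 1 / ((m : ℝ) + 1) with hδ
  set κ := 8 * C * Fintype.card ι * δ with hκ
  have hnt : ∀ s ∈ Icc 0 t, s ∈ Icc (0 : ℝ) n := fun s hs => ⟨hs.1, hs.2.trans hn⟩
  have hmt : ∀ s ∈ Icc 0 t, s ∈ Icc (0 : ℝ) m := fun s hs => ⟨hs.1, hs.2.trans hm⟩
  have hder : ∀ s ∈ Icc 0 t, HasDerivAt (fun r => energy ε (x n r - x m r) - κ * r)
      (2 * ∑ i, ((F (x n s) i + e n s i + q n s i) - (F (x m s) i + e m s i + q m s i)) *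
        (x n s - x m s) i - κ) s := by
    intro s hs
    have h1 := hasDerivAt_energy hε (x := fun r => x n r - x m r)
      (v := fun i => (F (x n s) i + e n s i + q n s i) - (F (x m s) i + e m s i + q m s i))
      (t := s) fun i => by
        rw [mul_sub]
        exact (h.hasDerivAt n s (hnt s hs) i).sub (h.hasDerivAt m s (hmt s hs) i)
    have h2 : HasDerivAt (fun r => κ * r) κ s := by
      simpa using! (hasDerivAt_id s).const_mul κ
    exact h1.sub h2
  have hanti : AntitoneOn (fun r => energy ε (x n r - x m r) - κ * r) (Icc 0 t) := by
    refine antitoneOn_of_deriv_nonpos (convex_Icc 0 t)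
      (fun s hs => (hder s hs).continuousAt.continuousWithinAt)
      (fun s hs => (hder s (interior_subset hs)).differentiableAt.differentiableWithinAt)
      fun s hs => ?_
    have hs' := interior_subset hs
    rw [(hder s hs').deriv]
    have key : ∀ i, ((F (x n s) i + e n s i + q n s i) - (F (x m s) i + e m s i + q m s i)) *
        (x n s - x m s) i ≤ (F (x n s) i - F (x m s) i) * (x n s i - x m s i) + 4 * C * δ := by
      intro i
      have hn' := hnt s hs'
      have hm' := hmt s hs'
      have x1 := abs_le.1 (h.abs_apply_le n s hn' i)
      have x2 := abs_le.1 (h.abs_apply_le m s hm' i)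
      have he : (e n s i - e m s i) * (x n s i - x m s i) ≤ 2 * C * δ := by
        have e1 : |e n s i - e m s i| ≤ δ := by
          have e2 := abs_le.1 (h.error_le n s hn' i)
          have e3 := abs_le.1 (h.error_le m s hm' i)
          rw [abs_le]
          exact ⟨by linarith, by linarith⟩
        have e4 : |x n s i - x m s i| ≤ 2 * C := by
          rw [abs_le]
          exact ⟨by linarith, by linarith⟩
        calc _ ≤ |(e n s i - e m s i) * (x n s i - x m s i)| := le_abs_self _
          _ = |e n s i - e m s i| * |x n s i - x m s i| := abs_mul _ _
          _ ≤ δ * (2 * C) := mul_le_mul e1 e4 (abs_nonneg _) ((abs_nonneg _).trans e1)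
          _ = 2 * C * δ := by ring
      -- a reaction force acts near the boundary only, where the other curve cannot be far below
      have hforce : ∀ {k l : ℕ}, s ∈ Icc (0 : ℝ) k → s ∈ Icc (0 : ℝ) l →
          q k s i * (x k s i - x l s i) ≤ C * (1 / ((k : ℝ) + 1) + 1 / ((l : ℝ) + 1)) := by
        intro k l hk hl
        have hpos : (0 : ℝ) < 1 / ((k : ℝ) + 1) + 1 / ((l : ℝ) + 1) := by positivity
        by_cases hi : i ∈ J
        · rcases le_total (1 / ((k : ℝ) + 1)) (x k s i) with hx | hx
          · rw [h.force_eq_zero_of_ge k s i hx, zero_mul]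
            positivity
          · have h1 : x k s i - x l s i ≤ 1 / ((k : ℝ) + 1) + 1 / ((l : ℝ) + 1) := by
              linarith [h.ge_neg l s hl i hi]
            calc _ ≤ q k s i * (1 / ((k : ℝ) + 1) + 1 / ((l : ℝ) + 1)) :=
                  mul_le_mul_of_nonneg_left h1 (h.force_nonneg k s hk i)
              _ ≤ _ := mul_le_mul_of_nonneg_right (h.force_le k s hk i) hpos.le
        · rw [h.force_eq_zero k s i hi, zero_mul]
          positivity
      have h1 := hforce hn' hm'
      have h2 := hforce hm' hn'
      have h3 : 1 / ((m : ℝ) + 1) + 1 / ((n : ℝ) + 1) = δ := by rw [hδ]; ring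
      rw [h3] at h2
      rw [← hδ] at h1
      simp only [Pi.sub_apply]
      nlinarith
    have h2 := Finset.sum_le_sum fun i (_ : i ∈ Finset.univ) => key i
    rw [Finset.sum_add_distrib] at h2
    have h3 := hF (x n s) (x m s)
    simp only [Finset.sum_const, Finset.card_univ, nsmul_eq_mul] at h2
    have h4 : κ = 2 * (Fintype.card ι * (4 * C * δ)) := by rw [hκ]; ring
    linarith
  have h1 := hanti ⟨le_rfl, ht⟩ ⟨ht, le_rfl⟩ ht
  simp only [h.init, sub_self, mul_zero, sub_zero] at h1
  have h2 : energy ε (0 : ι → ℝ) = 0 := by simp [energy]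
  linarith

/-- The limit of the approximations exists locally uniformly. -/
theorem exists_limit (hε : ∀ i, 0 < ε i) (hF : Dissipative F) (hC : 0 < C)
    (h : IsApproximation ε J F x₀ C x e q) :
    ∃ X : ℝ → ι → ℝ, ∀ t, 0 ≤ t → Tendsto (fun n => x n t) atTop (𝓝 (X t)) ∧
      ∀ n : ℕ, t ≤ n → energy ε (x n t - X t) ≤ 8 * C * Fintype.card ι * (1 / ((n : ℝ) + 1)) * t := by
  have hlim : ∀ t, 0 ≤ t → ∃ y, Tendsto (fun n => x n t) atTop (𝓝 y) := by
    intro t ht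
    suffices H : ∀ i, ∃ y, Tendsto (fun n => x n t i) atTop (𝓝 y) by
      choose y hy using H
      exact ⟨y, tendsto_pi_nhds.2 hy⟩
    refine fun i => cauchySeq_tendsto_of_complete ?_
    rw [Metric.cauchySeq_iff']
    intro η hη
    set κ := ε i * (8 * C * Fintype.card ι * t) with hκ
    have hκ0 : 0 ≤ κ := by have := hε i; positivity
    have hten : Tendsto (fun n : ℕ => κ * (2 * (1 / ((n : ℝ) + 1)))) atTop (𝓝 0) := by
      simpa using (tendsto_one_div_add_atTop_nhds_zero_nat (𝕜 := ℝ)).const_mul 2 |>.const_mul κ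
    obtain ⟨N, hN⟩ := (((tendsto_order.1 hten).2 (η ^ 2) (by positivity)).and
      (eventually_ge_atTop ⌈t⌉₊)).exists
    refine ⟨N, fun n hn => ?_⟩
    have htN : t ≤ N := (Nat.le_ceil t).trans (by exact_mod_cast hN.2)
    have hNn : (N : ℝ) ≤ n := by exact_mod_cast hn
    have h1 := (sq_le_mul_energy hε _ i).trans (mul_le_mul_of_nonneg_left
      (h.energy_sub_le hε hF hC ht (htN.trans hNn) htN) (hε i).le)
    rw [Real.dist_eq]
    refine abs_lt_of_sq_lt_sq ?_ hη.le
    have h2 : 1 / ((n : ℝ) + 1) ≤ 1 / ((N : ℝ) + 1) := by gcongr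
    calc (x n t i - x N t i) ^ 2 ≤ κ * (1 / ((n : ℝ) + 1) + 1 / ((N : ℝ) + 1)) := by
          simp only [Pi.sub_apply] at h1
          refine h1.trans (le_of_eq ?_)
          rw [hκ]; ring
      _ ≤ κ * (2 * (1 / ((N : ℝ) + 1))) := mul_le_mul_of_nonneg_left (by linarith) hκ0
      _ < η ^ 2 := hN.1
  choose! X hX using hlim
  refine ⟨X, fun t ht => ⟨hX t ht, fun n hn => ?_⟩⟩
  have h1 : Tendsto (fun m => energy ε (x n t - x m t)) atTop (𝓝 (energy ε (x n t - X t))) :=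
    (continuous_energy.tendsto _).comp (tendsto_const_nhds.sub (hX t ht))
  have h2 : Tendsto (fun m : ℕ => 8 * C * Fintype.card ι * (1 / ((n : ℝ) + 1) + 1 / ((m : ℝ) + 1))
      * t) atTop (𝓝 (8 * C * Fintype.card ι * (1 / ((n : ℝ) + 1) + 0) * t)) :=
    ((tendsto_const_nhds.add tendsto_one_div_add_atTop_nhds_zero_nat).const_mul _).mul_const _
  rw [add_zero] at h2
  refine le_of_tendsto_of_tendsto h1 h2 ?_
  filter_upwards [eventually_ge_atTop ⌈t⌉₊] with m hm
  exact h.energy_sub_le hε hF hC ht hn ((Nat.le_ceil t).trans (by exact_mod_cast hm))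

omit [Fintype ι] in
theorem abs_sub_le (hε : ∀ i, 0 < ε i) (h : IsApproximation ε J F x₀ C x e q) {n : ℕ} {s t : ℝ}
    (hs : s ∈ Icc (0 : ℝ) n) (ht : t ∈ Icc (0 : ℝ) n) (i : ι) :
    |x n t i - x n s i| ≤ ε i * (2 * C + 1) * |t - s| := by
  refine (convex_Icc (0 : ℝ) n).norm_image_sub_le_of_norm_hasDerivWithin_le
    (f := fun s => x n s i) (fun r hr => (h.hasDerivAt n r hr i).hasDerivWithinAt)
    (fun r hr => ?_) hs ht
  rw [norm_mul, Real.norm_of_nonneg (hε i).le]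
  refine mul_le_mul_of_nonneg_left ?_ (hε i).le
  have h1 := abs_le.1 (h.abs_field_le n r hr i)
  have h2 := abs_le.1 (h.error_le n r hr i)
  have h3 := h.force_nonneg n r hr i
  have h4 := h.force_le n r hr i
  have h5 : 1 / ((n : ℝ) + 1) ≤ 1 := by
    rw [div_le_one (by positivity)]; linarith [(Nat.cast_nonneg n : (0 : ℝ) ≤ n)]
  rw [Real.norm_eq_abs, abs_le]
  exact ⟨by linarith, by linarith⟩

end IsApproximation

/-- Projected dissipative dynamics with an equilibrium have a solution from every admissible initial
state. -/
theorem exists_isProjSolution (hε : ∀ i, 0 < ε i) {Φ : ι → ℝ → ℝ} {L : (ι → ℝ) → ι → ℝ}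
    (hΦ : ∀ i, ContDiff ℝ 1 (Φ i)) (hmono : ∀ i, Monotone (deriv (Φ i))) (hL : ContDiff ℝ 1 L)
    (hdL : Dissipative L) (hF : ∀ x i, F x i = -deriv (Φ i) (x i) + L x i) (hdF : Dissipative F)
    (hFc : Continuous F) {z : ι → ℝ}
    (hz : IsProjEquilibrium J F z) {x₀ : ι → ℝ} (hx₀ : ∀ i ∈ J, 0 ≤ x₀ i) :
    ∃ x, IsProjSolution ε J F x ∧ x 0 = x₀ := by
  obtain ⟨C, hC, x, e, q, h⟩ := exists_isApproximation hε hΦ hmono hL hdL hF hz hx₀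
  obtain ⟨X, hX⟩ := h.exists_limit hε hdF hC
  have hev : ∀ T : ℝ, ∀ᶠ n : ℕ in atTop, T ≤ n := fun T => by
    filter_upwards [eventually_ge_atTop ⌈T⌉₊] with m hm
    exact (Nat.le_ceil T).trans (by exact_mod_cast hm)
  have hlip : ∀ i, LipschitzWith ⟨ε i * (2 * C + 1), by have := hε i; positivity⟩
      fun t => X (max t 0) i := by
    refine fun i => LipschitzWith.of_dist_le_mul fun t s => ?_
    have hs := (continuous_apply i).continuousAt.tendsto.comp (hX (max s 0) (le_max_right _ _)).1
    have ht := (continuous_apply i).continuousAt.tendsto.comp (hX (max t 0) (le_max_right _ _)).1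
    rw [Real.dist_eq]
    refine le_of_tendsto (ht.sub hs).abs ?_
    filter_upwards [hev (max t 0), hev (max s 0)] with n hn hn'
    refine (h.abs_sub_le hε ⟨le_max_right _ _, hn'⟩ ⟨le_max_right _ _, hn⟩ i).trans ?_
    refine mul_le_mul_of_nonneg_left ?_ (by have := hε i; positivity)
    exact abs_max_sub_max_le_abs t s 0
  have hcont : Continuous fun t => X (max t 0) := continuous_pi fun i => (hlip i).continuous
  have hX0 : ∀ t, 0 ≤ t → ∀ i ∈ J, 0 ≤ X t i := by
    intro t ht i hi
    have h1 := (continuous_apply i).continuousAt.tendsto.comp (hX t ht).1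
    have h2 := (tendsto_one_div_add_atTop_nhds_zero_nat (𝕜 := ℝ)).neg
    rw [neg_zero] at h2
    refine le_of_tendsto_of_tendsto h2 h1 ?_
    filter_upwards [hev t] with n hn using h.ge_neg n t ⟨ht, hn⟩ i hi
  refine ⟨fun t => X (max t 0), fun i => CaratheodoryODE.of_lipschitzWith (hlip i) ?_, ?_⟩
  swap
  · simp only [max_self]
    refine tendsto_nhds_unique (hX 0 le_rfl).1 ?_
    simp [h.init]
  filter_upwards [(hlip i).ae_differentiableAt_real] with t₀ hdiff ht₀
  simp only [max_eq_left ht₀.le]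
  obtain ⟨D, hD⟩ : ∃ D, HasDerivAt (fun t => X (max t 0) i) D t₀ := ⟨_, hdiff.hasDerivAt⟩
  -- the approximations converge jointly in the index and the time
  have hE : ∀ᶠ p in (atTop : Filter ℕ) ×ˢ 𝓝 t₀, p.2 ∈ Icc (0 : ℝ) p.1 := by
    filter_upwards [prod_mem_prod (hev (t₀ + 1)) (Ioo_mem_nhds ht₀ (lt_add_one t₀))] with p hp
    exact ⟨hp.2.1.le, hp.2.2.le.trans hp.1⟩
  have hδ : Tendsto (fun p : ℕ × ℝ => 1 / ((p.1 : ℝ) + 1)) (atTop ×ˢ 𝓝 t₀) (𝓝 0) :=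
    tendsto_one_div_add_atTop_nhds_zero_nat.comp tendsto_fst
  have hjoint : Tendsto (fun p : ℕ × ℝ => x p.1 p.2) (atTop ×ˢ 𝓝 t₀) (𝓝 (X t₀)) := by
    have h1 : Tendsto (fun p : ℕ × ℝ => energy ε ((x p.1 p.2 - X (max p.2 0)) - 0))
        (atTop ×ˢ 𝓝 t₀) (𝓝 0) := by
      have h2 : Tendsto (fun p : ℕ × ℝ => 8 * C * Fintype.card ι * (1 / ((p.1 : ℝ) + 1)) * p.2)
          (atTop ×ˢ 𝓝 t₀) (𝓝 (8 * C * Fintype.card ι * 0 * t₀)) :=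
        (hδ.const_mul _).mul tendsto_snd
      rw [mul_zero, zero_mul] at h2
      refine squeeze_zero' (Eventually.of_forall fun p => energy_nonneg hε _) ?_ h2
      filter_upwards [hE] with p hp
      rw [sub_zero, max_eq_left hp.1]
      exact (hX p.2 hp.1).2 p.1 hp.2
    have h3 := (tendsto_of_energy_tendsto_zero hε h1).add
      ((hcont.tendsto t₀).comp (tendsto_snd (f := (atTop : Filter ℕ))))
    simpa [max_eq_left ht₀.le] using h3
  have hFi : Tendsto (fun p : ℕ × ℝ => F (x p.1 p.2) i) (atTop ×ˢ 𝓝 t₀) (𝓝 (F (X t₀) i)) :=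
    (((continuous_apply i).comp hFc).tendsto _).comp hjoint
  have hlim : ∀ᶠ t in 𝓝 t₀, Tendsto (fun n => x n t i) atTop (𝓝 (X (max t 0) i)) := by
    filter_upwards [Ioi_mem_nhds ht₀] with t ht
    rw [max_eq_left (le_of_lt ht)]
    exact (continuous_apply i).continuousAt.tendsto.comp (hX t (le_of_lt ht)).1
  -- the reaction forces are nonnegative
  have hlow : ε i * F (X t₀) i ≤ D := by
    refine le_of_forall_lt fun a ha => ?_
    obtain ⟨b, hab, hb⟩ := exists_between ha
    refine lt_of_lt_of_le hab (le_of_eventually_le_deriv (u := fun n t => x n t i)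
      (v := fun n t => ε i * (F (x n t) i + e n t i + q n t i)) hlim ?_ hD)
    have h1 : Tendsto (fun p : ℕ × ℝ => ε i * (F (x p.1 p.2) i - 1 / ((p.1 : ℝ) + 1)))
        (atTop ×ˢ 𝓝 t₀) (𝓝 (ε i * (F (X t₀) i - 0))) := (hFi.sub hδ).const_mul _
    rw [sub_zero] at h1
    filter_upwards [hE, (tendsto_order.1 h1).1 b hb] with p hp hbp
    refine ⟨h.hasDerivAt p.1 p.2 hp i, hbp.le.trans (mul_le_mul_of_nonneg_left ?_ (hε i).le)⟩
    linarith [h.force_nonneg p.1 p.2 hp i, (abs_le.1 (h.error_le p.1 p.2 hp i)).1]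
  -- they vanish away from the boundary
  have hup : (i ∉ J ∨ 0 < X t₀ i) → D ≤ ε i * F (X t₀) i := by
    intro hi
    have hq : ∀ᶠ p in (atTop : Filter ℕ) ×ˢ 𝓝 t₀, q p.1 p.2 i = 0 := by
      rcases hi with hi | hi
      · exact Eventually.of_forall fun p => h.force_eq_zero _ _ i hi
      · have h1 : Tendsto (fun p : ℕ × ℝ => x p.1 p.2 i) (atTop ×ˢ 𝓝 t₀) (𝓝 (X t₀ i)) :=
          ((continuous_apply i).tendsto _).comp hjoint
        filter_upwards [hδ.eventually_le_const (half_pos hi),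
          h1.eventually_const_le (half_lt_self hi)] with p hp1 hp2
        exact h.force_eq_zero_of_ge _ _ i (hp1.trans hp2)
    refine le_of_forall_gt fun a ha => ?_
    obtain ⟨b, hb, hba⟩ := exists_between ha
    refine lt_of_le_of_lt (neg_le_neg_iff.1 ?_) hba
    refine le_of_eventually_le_deriv (u := fun n t => -x n t i)
      (v := fun n t => -(ε i * (F (x n t) i + e n t i + q n t i)))
      (hlim.mono fun t ht => ht.neg) ?_ hD.neg
    have h1 : Tendsto (fun p : ℕ × ℝ => ε i * (F (x p.1 p.2) i + 1 / ((p.1 : ℝ) + 1)))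
        (atTop ×ˢ 𝓝 t₀) (𝓝 (ε i * (F (X t₀) i + 0))) := (hFi.add hδ).const_mul _
    rw [add_zero] at h1
    filter_upwards [hE, (tendsto_order.1 h1).2 b hb, hq] with p hp hbp hqp
    refine ⟨(h.hasDerivAt p.1 p.2 hp i).neg,
      neg_le_neg (le_trans (mul_le_mul_of_nonneg_left ?_ (hε i).le) hbp.le)⟩
    linarith [(abs_le.1 (h.error_le p.1 p.2 hp i)).2]
  refine hD.congr_deriv ?_
  by_cases hi : i ∈ J
  · simp only [projField, hi, if_true]
    rcases (hX0 t₀ ht₀.le i hi).eq_or_lt with h0 | h0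
    · have hmin : IsLocalMin (fun t => X (max t 0) i) t₀ := by
        refine Eventually.of_forall fun t => ?_
        simp only [max_eq_left ht₀.le, ← h0]
        exact hX0 _ (le_max_right _ _) i hi
      have hD0 := hmin.hasDerivAt_eq_zero hD
      have hF0 : F (X t₀) i ≤ 0 := by
        by_contra! hpos
        linarith [mul_pos (hε i) hpos]
      rw [hD0, (posProj_eq_zero_iff h0.le).2 ⟨hF0, by rw [← h0, mul_zero]⟩, mul_zero]
    · simp only [posProj, h0, or_true, if_true]
      exact le_antisymm (hup (Or.inr h0)) hlow
  · simp only [projField, hi, if_false]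
    exact le_antisymm (hup (Or.inl hi)) hlow

end

/-! ### Net outflows -/

section

variable {N A : Type*} [Fintype N] [DecidableEq N] [DecidableEq A]

omit [Fintype N] in
theorem netOutflow_sub {S : Finset (N × N)} (f f' : ↥S → ℝ) (i : N) :
    netOutflow (fun e => f e - f' e) i = netOutflow f i - netOutflow f' i := by
  simp only [netOutflow, Finset.sum_sub_distrib]
  ring

omit [Fintype N] in
theorem netOutflow_add_const_mul {S : Finset (N × N)} (f f' : ↥S → ℝ) (a : ℝ) (i : N) :
    netOutflow (fun e => f e + a * f' e) i = netOutflow f i + a * netOutflow f' i := by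
  simp only [netOutflow, Finset.sum_add_distrib, ← Finset.mul_sum]
  ring

/-- The net outflow is the adjoint of taking differences along lines. -/
theorem sum_mul_netOutflow {S : Finset (N × N)} (a : N → ℝ) (f : ↥S → ℝ) :
    ∑ i, a i * netOutflow f i = ∑ e : ↥S, (a e.1.1 - a e.1.2) * f e := by
  have h : ∀ p : ↥S → N, ∑ i, a i * ∑ e : ↥S with p e = i, f e = ∑ e : ↥S, a (p e) * f e := by
    intro p
    simp only [Finset.sum_filter, Finset.mul_sum]
    rw [Finset.sum_comm]
    simp
  simp only [netOutflow, mul_sub, sub_mul, Finset.sum_sub_distrib]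
  rw [h, h]

theorem sum_netOutflow {S : Finset (N × N)} (f : ↥S → ℝ) : ∑ i, netOutflow f i = 0 := by
  simpa using sum_mul_netOutflow (fun _ => 1) f

omit [Fintype N] in
@[fun_prop]
theorem continuous_netOutflow {S : Finset (N × N)} {X : Type*} [TopologicalSpace X]
    {f : X → ↥S → ℝ} (hf : ∀ e, Continuous fun x => f x e) (i : N) :
    Continuous fun x => netOutflow (f x) i :=
  (continuous_finsetSum _ fun e _ => hf e).sub (continuous_finsetSum _ fun e _ => hf e)

/-! ### Coordinates of the closed loop -/

/-- The independent coordinates of the closed loop: the frequencies of the load buses are determined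
algebraically, and `μ` replaces `r`. -/
inductive Coord (net : Network N A)
  | d (i : N)
  | ω (i : ↥net.gen)
  | P (e : ↥net.E)
  | ψ (i : N)
  | μ (i : N)
  | γp (i : N)
  | γm (i : N)
  | σp (e : ↥net.Ein)
  | σm (e : ↥net.Ein)

namespace Coord

variable (net : Network N A)

/-- The blocks of coordinates. -/
def equivSum : Coord net ≃ N ⊕ ↥net.gen ⊕ ↥net.E ⊕ N ⊕ N ⊕ N ⊕ N ⊕ ↥net.Ein ⊕ ↥net.Ein where
  toFun
    | d i => .inl i
    | ω i => .inr (.inl i)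
    | P e => .inr (.inr (.inl e))
    | ψ i => .inr (.inr (.inr (.inl i)))
    | μ i => .inr (.inr (.inr (.inr (.inl i))))
    | γp i => .inr (.inr (.inr (.inr (.inr (.inl i)))))
    | γm i => .inr (.inr (.inr (.inr (.inr (.inr (.inl i))))))
    | σp e => .inr (.inr (.inr (.inr (.inr (.inr (.inr (.inl e)))))))
    | σm e => .inr (.inr (.inr (.inr (.inr (.inr (.inr (.inr e)))))))
  invFun := Sum.elim d <| Sum.elim ω <| Sum.elim P <| Sum.elim ψ <| Sum.elim μ <|
    Sum.elim γp <| Sum.elim γm <| Sum.elim σp σm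
  left_inv k := by cases k <;> rfl
  right_inv k := by rcases k with k | k | k | k | k | k | k | k | k <;> rfl

instance : Fintype (Coord net) := Fintype.ofEquiv _ (equivSum net).symm

variable {net}

theorem sum_eq (f : Coord net → ℝ) : ∑ k, f k = ∑ i, f (d i) + ∑ i, f (ω i) + ∑ e, f (P e)
    + ∑ i, f (ψ i) + ∑ i, f (μ i) + ∑ i, f (γp i) + ∑ i, f (γm i) + ∑ e, f (σp e)
    + ∑ e, f (σm e) := by
  rw [← (equivSum net).symm.sum_comp]
  simp only [Fintype.sum_sum_type, equivSum, Equiv.coe_fn_symm_mk, Sum.elim_inl, Sum.elim_inr]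
  ring

variable (net) in
/-- The multipliers of the inequality constraints. -/
def multipliers : Set (Coord net) := range γp ∪ range γm ∪ range σp ∪ range σm

/-- The frequencies: a coordinate at generator buses, and determined by the power balance at load
buses. -/
noncomputable def freq (x : Coord net → ℝ) (i : N) : ℝ :=
  if h : i ∈ net.gen then x (ω ⟨i, h⟩)
  else -(x (d i) - net.Pin i + netOutflow (fun e => x (P e)) i) / net.D i

/-- The closed loop without step sizes and projections: it descends in `d`, `P`, `ψ` and ascends in
the other coordinates for the Lagrangian of the reformulated problem in which `ω` at generator
buses is the multiplier of the power balance and `ω` at load buses is eliminated. -/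
noncomputable def field (c : N → ℝ → ℝ) (x : Coord net → ℝ) : Coord net → ℝ
  | d i => -deriv (c i) (x (d i)) + (freq x i + x (μ i) - x (γp i) + x (γm i))
  | ω i => -(net.D i * x (ω i) + x (d i) - net.Pin i + netOutflow (fun e => x (P e)) i)
  | P e => freq x e.1.1 - freq x e.1.2
  | ψ i => netOutflow (fun e : ↥net.Ein => net.B e.1.1 e.1.2 *
      (x (μ e.1.1) - x (μ e.1.2) - x (σp e) + x (σm e))) i
  | μ i => -x (d i) + net.Pin i - netOutflow (net.innerFlow fun j => x (ψ j)) i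
  | γp i => x (d i) - net.dhi i
  | γm i => -x (d i) + net.dlo i
  | σp e => net.innerFlow (fun j => x (ψ j)) e - net.Phi e.1.1 e.1.2
  | σm e => -net.innerFlow (fun j => x (ψ j)) e + net.Plo e.1.1 e.1.2

/-- The step sizes of all coordinates; for the physical ones they are dictated by the network. -/
noncomputable def step (g : Gains N) : Coord net → ℝ
  | d i => g.εd i
  | ω i => 1 / net.M i
  | P e => net.B e.1.1 e.1.2
  | ψ i => g.εψ i
  | μ i => g.εμ i
  | γp i => g.εγp i
  | γm i => g.εγm i
  | σp e => g.εσp e.1.1 e.1.2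
  | σm e => g.εσm e.1.1 e.1.2

theorem step_pos (g : Gains N) (k : Coord net) : 0 < step g k := by
  cases k with
  | d i => exact g.εd_pos i
  | ω i => exact one_div_pos.2 (net.M_pos i i.2)
  | P e => exact net.B_pos _ _ e.2
  | ψ i => exact g.εψ_pos i
  | μ i => exact g.εμ_pos i
  | γp i => exact g.εγp_pos i
  | γm i => exact g.εγm_pos i
  | σp e => exact g.εσp_pos _ _
  | σm e => exact g.εσm_pos _ _

/-- The costs as functions of the single coordinates. -/
noncomputable def cost (c : N → ℝ → ℝ) : Coord net → ℝ → ℝ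
  | d i => c i
  | _ => fun _ => 0

theorem field_eq (c : N → ℝ → ℝ) (x : Coord net → ℝ) (k : Coord net) :
    field c x k = -deriv (cost c k) (x k) + field (fun _ _ => 0) x k := by
  cases k <;> simp [field, cost]

theorem contDiff_freq (i : N) : ContDiff ℝ 1 fun x : Coord net → ℝ => freq x i := by
  unfold freq netOutflow
  split_ifs <;> fun_prop

theorem contDiff_field_zero : ContDiff ℝ 1 (field (net := net) fun _ _ => 0) := by
  refine contDiff_pi.2 fun k => ?_
  have := contDiff_freq (net := net)
  cases k <;> simp only [field, netOutflow, Network.innerFlow, deriv_const] <;> fun_prop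

theorem continuous_freq (i : N) : Continuous fun x : Coord net → ℝ => freq x i :=
  (contDiff_freq i).continuous

theorem continuous_field {c : N → ℝ → ℝ} (hc : ∀ i, ContDiff ℝ 1 (c i)) :
    Continuous (field (net := net) c) := by
  refine continuous_pi fun k => ?_
  simp_rw [field_eq c]
  refine Continuous.add (Continuous.neg ?_) (continuous_pi_iff.1 contDiff_field_zero.continuous k)
  cases k with
  | d i => exact (hc i).continuous_deriv_one.comp (continuous_apply _)
  | _ => simpa [cost] using continuous_const

/-- Power is balanced at load buses; at generator buses, the imbalance drives the frequency. -/
theorem balance_freq (x : Coord net → ℝ) {i : N} (hi : i ∉ net.gen) :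
    net.D i * freq x i + x (d i) - net.Pin i + netOutflow (fun e => x (P e)) i = 0 := by
  have := (net.D_pos i).ne'
  simp only [freq, hi, dif_neg, not_false_eq_true]
  field_simp
  ring

/-- All terms that are bilinear in primal and dual coordinates cancel: only the strict monotonicity
of the marginal costs and the damping dissipate. -/
theorem sum_field_sub_mul_sub (c : N → ℝ → ℝ) (x y : Coord net → ℝ) :
    ∑ k, (field c x k - field c y k) * (x k - y k) =
      -∑ i, (deriv (c i) (x (d i)) - deriv (c i) (y (d i))) * (x (d i) - y (d i))
        - ∑ i, net.D i * (freq x i - freq y i) ^ 2 := by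
  set Q : N → ℝ := fun i => netOutflow (fun e : ↥net.E => x (P e) - y (P e)) i with hQ
  set w : N → ℝ := fun i => freq x i - freq y i with hw
  have hω : ∑ i : ↥net.gen, (field c x (ω i) - field c y (ω i)) * (x (ω i) - y (ω i))
      = ∑ i, -(net.D i * w i + (x (d i) - y (d i)) + Q i) * w i := by
    have h1 : ∀ i ∈ (Finset.univ : Finset N), i ∉ net.gen →
        -(net.D i * w i + (x (d i) - y (d i)) + Q i) * w i = 0 := by
      intro i _ hi
      have hx := balance_freq x hi
      have hy := balance_freq y hi
      have : net.D i * w i + (x (d i) - y (d i)) + Q i = 0 := by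
        simp only [hw, hQ, netOutflow_sub]
        linarith
      rw [this, neg_zero, zero_mul]
    rw [← Finset.sum_subset (Finset.subset_univ net.gen) h1, ← Finset.sum_coe_sort net.gen]
    refine Finset.sum_congr rfl fun i _ => ?_
    have hi : ∀ u : Coord net → ℝ, freq u i = u (ω i) := fun u => by simp [freq]
    simp only [hw, hQ, netOutflow_sub, field, hi]
    ring
  have hP : ∑ e : ↥net.E, (field c x (P e) - field c y (P e)) * (x (P e) - y (P e))
      = ∑ i, w i * Q i := by
    simp only [hQ]
    rw [sum_mul_netOutflow]
    refine Finset.sum_congr rfl fun e _ => ?_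
    simp only [field, hw]
    ring
  have hψ : ∑ i, (field c x (ψ i) - field c y (ψ i)) * (x (ψ i) - y (ψ i))
      = ∑ e : ↥net.Ein, ((x (ψ e.1.1) - y (ψ e.1.1)) - (x (ψ e.1.2) - y (ψ e.1.2))) *
        (net.B e.1.1 e.1.2 * (x (μ e.1.1) - x (μ e.1.2) - x (σp e) + x (σm e)) -
          net.B e.1.1 e.1.2 * (y (μ e.1.1) - y (μ e.1.2) - y (σp e) + y (σm e))) := by
    rw [← sum_mul_netOutflow (fun i => x (ψ i) - y (ψ i))]
    refine Finset.sum_congr rfl fun i _ => ?_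
    rw [netOutflow_sub, mul_comm]
    rfl
  have hμ : ∑ i, (field c x (μ i) - field c y (μ i)) * (x (μ i) - y (μ i))
      = ∑ i, -(x (d i) - y (d i)) * (x (μ i) - y (μ i)) -
        ∑ e : ↥net.Ein, ((x (μ e.1.1) - y (μ e.1.1)) - (x (μ e.1.2) - y (μ e.1.2))) *
          (net.innerFlow (fun j => x (ψ j)) e - net.innerFlow (fun j => y (ψ j)) e) := by
    rw [← sum_mul_netOutflow (fun i => x (μ i) - y (μ i)), ← Finset.sum_sub_distrib]
    refine Finset.sum_congr rfl fun i _ => ?_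
    rw [netOutflow_sub]
    simp only [field]
    ring
  rw [sum_eq, hω, hP, hψ, hμ, ← sub_eq_zero]
  have hN : ∑ i, ((field c x (d i) - field c y (d i)) * (x (d i) - y (d i))
      + -(net.D i * w i + (x (d i) - y (d i)) + Q i) * w i + w i * Q i
      + -(x (d i) - y (d i)) * (x (μ i) - y (μ i))
      + (field c x (γp i) - field c y (γp i)) * (x (γp i) - y (γp i))
      + (field c x (γm i) - field c y (γm i)) * (x (γm i) - y (γm i))
      + (deriv (c i) (x (d i)) - deriv (c i) (y (d i))) * (x (d i) - y (d i))
      + net.D i * w i ^ 2) = 0 :=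
    Finset.sum_eq_zero fun i _ => by
      simp only [field, hw]
      ring
  have hE : ∑ e : ↥net.Ein, (((x (ψ e.1.1) - y (ψ e.1.1)) - (x (ψ e.1.2) - y (ψ e.1.2))) *
        (net.B e.1.1 e.1.2 * (x (μ e.1.1) - x (μ e.1.2) - x (σp e) + x (σm e)) -
          net.B e.1.1 e.1.2 * (y (μ e.1.1) - y (μ e.1.2) - y (σp e) + y (σm e)))
      - ((x (μ e.1.1) - y (μ e.1.1)) - (x (μ e.1.2) - y (μ e.1.2))) *
          (net.innerFlow (fun j => x (ψ j)) e - net.innerFlow (fun j => y (ψ j)) e)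
      + (field c x (σp e) - field c y (σp e)) * (x (σp e) - y (σp e))
      + (field c x (σm e) - field c y (σm e)) * (x (σm e) - y (σm e))) = 0 :=
    Finset.sum_eq_zero fun e _ => by
      simp only [field, Network.innerFlow]
      ring
  simp only [Finset.sum_add_distrib, Finset.sum_sub_distrib] at hN hE
  linarith

theorem dissipative_field {c : N → ℝ → ℝ} (hm : ∀ i, Monotone (deriv (c i))) :
    Dissipative (field (net := net) c) := by
  intro x y
  rw [sum_field_sub_mul_sub]
  have h1 : 0 ≤ ∑ i, (deriv (c i) (x (d i)) - deriv (c i) (y (d i))) * (x (d i) - y (d i)) := by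
    refine Finset.sum_nonneg fun i _ => ?_
    rcases le_total (x (d i)) (y (d i)) with h | h
    · exact mul_nonneg_of_nonpos_of_nonpos (sub_nonpos.2 (hm i h)) (sub_nonpos.2 h)
    · exact mul_nonneg (sub_nonneg.2 (hm i h)) (sub_nonneg.2 h)
  have h2 : 0 ≤ ∑ i, net.D i * (freq x i - freq y i) ^ 2 :=
    Finset.sum_nonneg fun i _ => mul_nonneg (net.D_pos i).le (sq_nonneg _)
  linarith

/-! ### From coordinates to states and back -/

/-- The coordinates of a state. -/
noncomputable def ofState (g : Gains N) (s : State net) : Coord net → ℝ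
  | d i => s.d i
  | ω i => s.ω i
  | P e => s.P e
  | ψ i => s.ψ i
  | μ i => s.μ g i
  | γp i => s.γp i
  | γm i => s.γm i
  | σp e => s.σp e
  | σm e => s.σm e

/-- The state with given coordinates. -/
noncomputable def toState (g : Gains N) (x : Coord net → ℝ) : State net where
  d i := x (d i)
  ω := freq x
  P e := x (P e)
  ψ i := x (ψ i)
  γp i := x (γp i)
  γm i := x (γm i)
  r i := g.K i / g.εμ i * (x (μ i) - if i ∈ net.gen then g.εμ i * net.M i * freq x i else 0)
  σp e := x (σp e)
  σm e := x (σm e)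

variable (g : Gains N) (c : N → ℝ → ℝ) (x : Coord net → ℝ)

theorem toState_μ (i : N) : (toState g x).μ g i = x (μ i) := by
  have h1 := (g.εμ_pos i).ne'
  have h2 := (g.K_pos i).ne'
  by_cases hi : i ∈ net.gen
  · have h3 := (net.M_pos i hi).ne'
    simp only [State.μ, toState, hi, if_true, State.εω]
    field_simp
    ring
  · simp only [State.μ, toState, hi, if_false]
    field_simp
    ring

theorem freq_ofState {s : State net} (hs : ∀ i, i ∉ net.gen → s.imbalance i = 0) :
    freq (ofState g s) = s.ω := by
  funext i
  by_cases hi : i ∈ net.gen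
  · simp [freq, hi, ofState]
  · have h1 := hs i hi
    have h2 := (net.D_pos i).ne'
    simp only [State.imbalance] at h1
    simp only [freq, hi, dif_neg, not_false_eq_true, ofState]
    field_simp
    linarith

theorem toState_ofState {s : State net} (hs : ∀ i, i ∉ net.gen → s.imbalance i = 0) :
    toState g (ofState g s) = s := by
  have hf := freq_ofState g hs
  ext i
  case ω => exact congrFun hf i
  case r =>
    have h1 := (g.εμ_pos i).ne'
    have h2 := (g.K_pos i).ne'
    by_cases hi : i ∈ net.gen
    · have h3 := (net.M_pos i hi).ne'
      simp only [toState, hf, ofState, State.μ, hi, if_true, State.εω]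
      field_simp
      ring
    · simp only [toState, ofState, State.μ, hi, if_false]
      field_simp
      ring
  all_goals rfl

theorem toState_imbalance {i : N} (hi : i ∉ net.gen) : (toState g x).imbalance i = 0 :=
  balance_freq x hi

theorem toState_rateω (i : ↥net.gen) :
    (toState g x).rateω i = step g (ω i) * field c x (ω i) := by
  have h : freq x i = x (ω i) := by simp [freq]
  simp only [State.rateω, State.imbalance, toState, step, field, h]
  ring

theorem toState_rateP (e : ↥net.E) : (toState g x).rateP e = step g (P e) * field c x (P e) := rfl

theorem toState_rated (i : N) :
    (toState g x).rated g c i = step (net := net) g (d i) * field c x (d i) := by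
  have h := toState_μ g x i
  simp only [State.μ] at h
  have h1 := (g.εμ_pos i).ne'
  have h2 := (g.K_pos i).ne'
  simp only [State.rated, State.η, step, field]
  congr 1
  by_cases hi : i ∈ net.gen
  · have h3 := (net.M_pos i hi).ne'
    simp only [hi, if_true, State.εω] at h ⊢
    rw [← h]
    simp only [toState, hi, if_true]
    field_simp
    ring
  · simp only [hi, if_false] at h ⊢
    rw [← h]
    simp only [toState]
    ring

theorem toState_rateψ (i : N) :
    (toState g x).rateψ g i = step (net := net) g (ψ i) * field c x (ψ i) := by
  simp only [State.rateψ, step, field, toState_μ, netOutflow]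
  congr 1
  rw [sub_eq_add_neg, ← Finset.sum_neg_distrib]
  congr 1
  · refine Finset.sum_congr rfl fun e he => ?_
    rw [(Finset.mem_filter.1 he).2]
    simp only [toState]
    ring
  · refine Finset.sum_congr rfl fun e he => ?_
    rw [(Finset.mem_filter.1 he).2]
    simp only [toState]
    ring

theorem toState_rater (i : N) :
    (toState g x).rater g i = g.K i / g.εμ i * (step (net := net) g (μ i) * field c x (μ i)
      - if i ∈ net.gen then g.εμ i * net.M i * (toState g x).rateω i else 0) := by
  have h1 := (g.εμ_pos i).ne'
  by_cases hi : i ∈ net.gen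
  · have h3 := (net.M_pos i hi).ne'
    simp only [State.rater, State.rateω, State.imbalance, step, field, hi, if_true, toState]
    field_simp
    ring
  · have hb := balance_freq x hi
    simp only [State.rater, step, field, hi, if_false, toState]
    field_simp
    linear_combination g.K i * g.εμ i * hb

theorem projField_of_multiplier {J : Set (Coord net)} {F : (Coord net → ℝ) → Coord net → ℝ}
    {k : Coord net} (hk : k ∈ J) : projField J F x k = posProj (F x k) (x k) := by
  simp [projField, hk]

theorem projField_γp (i : N) : projField (multipliers net) (field c) x (γp i)
    = posProj (x (d i) - net.dhi i) (x (γp i)) := by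
  simp [projField, multipliers, field]

theorem projField_γm (i : N) : projField (multipliers net) (field c) x (γm i)
    = posProj (-x (d i) + net.dlo i) (x (γm i)) := by
  simp [projField, multipliers, field]

theorem projField_σp (e : ↥net.Ein) : projField (multipliers net) (field c) x (σp e)
    = posProj (net.innerFlow (fun j => x (ψ j)) e - net.Phi e.1.1 e.1.2) (x (σp e)) := by
  simp [projField, multipliers, field]

theorem projField_σm (e : ↥net.Ein) : projField (multipliers net) (field c) x (σm e)
    = posProj (-net.innerFlow (fun j => x (ψ j)) e + net.Plo e.1.1 e.1.2) (x (σm e)) := by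
  simp [projField, multipliers, field]

theorem projField_of_free {k : Coord net} (hk : k ∉ multipliers net) :
    projField (multipliers net) (field c) x k = field c x k := by
  simp [projField, hk]

end Coord

end

section

variable {N A : Type*} [Fintype N] [DecidableEq N] [DecidableEq A]

namespace Coord

variable {net : Network N A} {g : Gains N} {c : N → ℝ → ℝ}

theorem isProjSolution_ofState {x : ℝ → State net} (hx : IsSolution g c x) :
    IsProjSolution (step g) (multipliers net) (field c) fun t => ofState g (x t) := by
  have hb : ∀ t, 0 ≤ t → toState g (ofState g (x t)) = x t := fun t ht =>
    toState_ofState g fun i hi => (hx.balance t ht i hi).symm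
  intro k
  cases k with
  | d i =>
    refine (hx.d i).congr_rate fun t ht => ?_
    have h := toState_rated g c (ofState g (x t)) i
    rw [hb t ht] at h
    rw [h, projField_of_free _ _ (by simp [multipliers])]
  | ω i =>
    refine (hx.ω i i.2).congr_rate fun t ht => ?_
    have h := toState_rateω g c (ofState g (x t)) i
    rw [hb t ht] at h
    rw [h, projField_of_free _ _ (by simp [multipliers])]
  | P e =>
    refine (hx.P e).congr_rate fun t ht => ?_
    have h := toState_rateP g c (ofState g (x t)) e
    rw [hb t ht] at h
    rw [h, projField_of_free _ _ (by simp [multipliers])]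
  | ψ i =>
    refine (hx.ψ i).congr_rate fun t ht => ?_
    have h := toState_rateψ g c (ofState g (x t)) i
    rw [hb t ht] at h
    rw [h, projField_of_free _ _ (by simp [multipliers])]
  | μ i =>
    have h1 := (g.εμ_pos i).ne'
    have h2 := (g.K_pos i).ne'
    have hr : ∀ t, 0 ≤ t → (x t).rater g i = g.K i / g.εμ i *
        (step (net := net) g (μ i) * field c (ofState g (x t)) (μ i)
          - if i ∈ net.gen then g.εμ i * net.M i * (x t).rateω i else 0) := fun t ht => by
      have h := toState_rater g c (ofState g (x t)) i
      rwa [hb t ht] at h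
    by_cases hi : i ∈ net.gen
    · refine ((((hx.ω i hi).const_mul (g.εμ i / State.εω net i)).add
        ((hx.r i).const_mul (g.εμ i / g.K i))).congr_rate fun t ht => ?_).congr_fun fun t _ => ?_
      · rw [projField_of_free _ _ (by simp [multipliers]), hr t ht]
        have h3 := (net.M_pos i hi).ne'
        simp only [hi, if_true, State.εω]
        field_simp
        ring
      · simp [ofState, State.μ, hi]
    · refine (((hx.r i).const_mul (g.εμ i / g.K i)).congr_rate fun t ht => ?_).congr_fun
        fun t _ => ?_
      · rw [projField_of_free _ _ (by simp [multipliers]), hr t ht]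
        simp only [hi, if_false]
        field_simp
        ring
      · simp [ofState, State.μ, hi]
  | γp i => exact (hx.γp i).congr_rate fun t _ => by rw [projField_γp]; rfl
  | γm i => exact (hx.γm i).congr_rate fun t _ => by rw [projField_γm]; rfl
  | σp e => exact (hx.σp e).congr_rate fun t _ => by rw [projField_σp]; rfl
  | σm e => exact (hx.σm e).congr_rate fun t _ => by rw [projField_σm]; rfl

theorem isSolution_toState {y : ℝ → Coord net → ℝ}
    (hy : IsProjSolution (step g) (multipliers net) (field c) y) :
    IsSolution g c fun t => toState g (y t) := by
  have hω : ∀ i, ∀ hi : i ∈ net.gen, CaratheodoryODE (fun t => (toState g (y t)).ω i)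
      fun t => (toState g (y t)).rateω i := fun i hi => by
    refine ((hy (ω ⟨i, hi⟩)).congr_rate fun t _ => ?_).congr_fun fun t _ => ?_
    · rw [projField_of_free _ _ (by simp [multipliers]), ← toState_rateω]
    · simp [toState, freq, hi]
  refine ⟨fun t _ i hi => (toState_imbalance g _ hi).symm, hω, fun e => ?_, fun i => ?_,
    fun i => ?_, fun i => ?_, fun i => ?_, fun i => ?_, fun e => ?_, fun e => ?_⟩
  · refine (hy (P e)).congr_rate fun t _ => ?_
    rw [projField_of_free _ _ (by simp [multipliers]), ← toState_rateP]
  · refine (hy (d i)).congr_rate fun t _ => ?_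
    rw [projField_of_free _ _ (by simp [multipliers]), ← toState_rated]
  · refine (hy (ψ i)).congr_rate fun t _ => ?_
    rw [projField_of_free _ _ (by simp [multipliers]), ← toState_rateψ]
  · exact (hy (γp i)).congr_rate fun t _ => by rw [projField_γp]; rfl
  · exact (hy (γm i)).congr_rate fun t _ => by rw [projField_γm]; rfl
  · by_cases hi : i ∈ net.gen
    · refine ((((hy (μ i)).sub ((hω i hi).const_mul (g.εμ i * net.M i))).const_mul
        (g.K i / g.εμ i)).congr_rate fun t _ => ?_).congr_fun fun t _ => ?_
      · rw [projField_of_free _ _ (by simp [multipliers]), toState_rater g c]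
        simp [hi]
      · simp [toState, hi]
    · refine (((hy (μ i)).const_mul (g.K i / g.εμ i)).congr_rate fun t _ => ?_).congr_fun
        fun t _ => ?_
      · rw [projField_of_free _ _ (by simp [multipliers]), toState_rater g c]
        simp [hi]
      · simp [toState, hi]
  · exact (hy (σp e)).congr_rate fun t _ => by rw [projField_σp]; rfl
  · exact (hy (σm e)).congr_rate fun t _ => by rw [projField_σm]; rfl

theorem field_eq_zero {z : Coord net → ℝ} (hz : IsProjEquilibrium (multipliers net) (field c) z)
    {k : Coord net} (hk : k ∉ multipliers net) : field c z k = 0 := by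
  rw [← projField_of_free c z hk]
  exact hz.2 k

theorem complementarity {z : Coord net → ℝ}
    (hz : IsProjEquilibrium (multipliers net) (field c) z) {k : Coord net}
    (hk : k ∈ multipliers net) : 0 ≤ z k ∧ field c z k ≤ 0 ∧ field c z k * z k = 0 := by
  refine ⟨hz.1 k hk, (posProj_eq_zero_iff (hz.1 k hk)).1 ?_⟩
  rw [← projField_of_multiplier z hk]
  exact hz.2 k

theorem γp_mem (i : N) : γp i ∈ multipliers net := by simp [multipliers]
theorem γm_mem (i : N) : γm i ∈ multipliers net := by simp [multipliers]
theorem σp_mem (e : ↥net.Ein) : σp e ∈ multipliers net := by simp [multipliers]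
theorem σm_mem (e : ↥net.Ein) : σm e ∈ multipliers net := by simp [multipliers]

theorem isEquilibrium_toState {z : Coord net → ℝ}
    (hz : IsProjEquilibrium (multipliers net) (field c) z) :
    (toState g z).IsEquilibrium g c := by
  have hω : ∀ i ∈ net.gen, (toState g z).rateω i = 0 := fun i hi => by
    rw [toState_rateω g c z ⟨i, hi⟩, field_eq_zero hz (by simp [multipliers]), mul_zero]
  refine ⟨⟨fun i hi => toState_imbalance g z hi, fun i => hz.1 _ (γp_mem i),
    fun i => hz.1 _ (γm_mem i), fun e => hz.1 _ (σp_mem e), fun e => hz.1 _ (σm_mem e)⟩, hω,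
    fun e => ?_, fun i => ?_, fun i => ?_, fun i => ?_, fun i => ?_, fun i => ?_, fun e => ?_,
    fun e => ?_⟩
  · rw [toState_rateP g c, field_eq_zero hz (by simp [multipliers]), mul_zero]
  · rw [toState_rated g c, field_eq_zero hz (by simp [multipliers]), mul_zero]
  · rw [toState_rateψ g c, field_eq_zero hz (by simp [multipliers]), mul_zero]
  · have h := hz.2 (γp i)
    rw [projField_γp] at h
    exact mul_eq_zero_of_right _ h
  · have h := hz.2 (γm i)
    rw [projField_γm] at h
    exact mul_eq_zero_of_right _ h
  · rw [toState_rater g c, field_eq_zero hz (by simp [multipliers])]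
    by_cases hi : i ∈ net.gen
    · simp [hω i hi]
    · simp [hi]
  · have h := hz.2 (σp e)
    rw [projField_σp] at h
    exact mul_eq_zero_of_right _ h
  · have h := hz.2 (σm e)
    rw [projField_σm] at h
    exact mul_eq_zero_of_right _ h

/-! ### Equilibria are optimal -/

/-- At an equilibrium the frequency is the same at all buses, because the network is connected, and
the sum of all power balances shows that it vanishes. -/
theorem freq_eq_zero {z : Coord net → ℝ} (hz : IsProjEquilibrium (multipliers net) (field c) z)
    (i : N) : freq z i = 0 := by
  have hedge : ∀ a b, (a, b) ∈ net.E → freq z a = freq z b := fun a b hab => by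
    have h := field_eq_zero hz (k := P ⟨(a, b), hab⟩) (by simp [multipliers])
    simp only [field] at h
    linarith
  have hconst : ∀ j, freq z j = freq z i := by
    intro j
    obtain ⟨w⟩ := net.connected.preconnected j i
    induction w with
    | nil => rfl
    | cons hadj _ ih =>
      rw [← ih]
      rw [SimpleGraph.fromRel_adj] at hadj
      rcases hadj.2 with h | h
      · exact hedge _ _ h
      · exact (hedge _ _ h).symm
  have hbal : ∀ j, net.D j * freq z j + z (d j) - net.Pin j
      + netOutflow (fun e => z (P e)) j = 0 := by
    intro j
    by_cases hj : j ∈ net.gen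
    · have h := field_eq_zero hz (k := ω ⟨j, hj⟩) (by simp [multipliers])
      have h2 : freq z j = z (ω ⟨j, hj⟩) := by simp [freq, hj]
      simp only [field] at h
      rw [h2]
      linarith
    · exact balance_freq z hj
  have hsum : ∑ j, net.D j * freq z i = 0 := by
    have h : ∀ j, net.D j * freq z i = netOutflow (net.innerFlow fun k => z (ψ k)) j
        - netOutflow (fun e => z (P e)) j := fun j => by
      have h1 := field_eq_zero hz (k := μ j) (by simp [multipliers])
      simp only [field] at h1
      have h2 := hbal j
      rw [hconst j] at h2
      linarith
    simp only [h, Finset.sum_sub_distrib, sum_netOutflow, sub_zero]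
  rw [← Finset.sum_mul] at hsum
  have : 0 < ∑ j, net.D j := Finset.sum_pos (fun j _ => net.D_pos j) ⟨i, Finset.mem_univ i⟩
  exact (mul_eq_zero.1 hsum).resolve_left this.ne'

theorem balance_of_equilibrium {z : Coord net → ℝ}
    (hz : IsProjEquilibrium (multipliers net) (field c) z) (i : N) :
    z (d i) = net.Pin i - net.D i * freq z i - netOutflow (fun e => z (P e)) i := by
  by_cases hj : i ∈ net.gen
  · have h := field_eq_zero hz (k := ω ⟨i, hj⟩) (by simp [multipliers])
    have h2 : freq z i = z (ω ⟨i, hj⟩) := by simp [freq, hj]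
    simp only [field] at h
    rw [h2]
    linarith
  · linarith [balance_freq z hj]

theorem _root_.ConvexOn.add_deriv_mul_le {f : ℝ → ℝ} (hf : ConvexOn ℝ univ f) {x : ℝ}
    (hd : DifferentiableAt ℝ f x) (y : ℝ) : f x + deriv f x * (y - x) ≤ f y := by
  rcases lt_trichotomy x y with h | rfl | h
  · have h1 := hf.deriv_le_slope (mem_univ x) (mem_univ y) h hd
    rw [slope_def_field, le_div_iff₀ (by linarith)] at h1
    linarith
  · simp
  · have h1 := hf.slope_le_deriv (mem_univ y) (mem_univ x) h hd
    rw [slope_def_field, div_le_iff₀ (by linarith)] at h1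
    linarith

/-- The Karush-Kuhn-Tucker conditions, which hold at equilibria, are sufficient by convexity. -/
theorem isOptimal_toState (hconv : ∀ i, ConvexOn ℝ univ (c i)) (hC1 : ∀ i, ContDiff ℝ 1 (c i))
    {z : Coord net → ℝ} (hz : IsProjEquilibrium (multipliers net) (field c) z) :
    net.IsOptimal c (toState g z).d (toState g z).ω (toState g z).P (toState g z).ψ := by
  have hγp := fun i => complementarity hz (γp_mem i)
  have hγm := fun i => complementarity hz (γm_mem i)
  have hσp := fun e => complementarity hz (σp_mem e)
  have hσm := fun e => complementarity hz (σm_mem e)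
  simp only [field] at hγp hγm hσp hσm
  have hvirt : ∀ i, z (d i) = net.Pin i - netOutflow (net.innerFlow fun j => z (ψ j)) i :=
    fun i => by
      have h := field_eq_zero hz (k := μ i) (by simp [multipliers])
      simp only [field] at h
      linarith
  refine ⟨⟨balance_of_equilibrium hz, fun i => ⟨?_, ?_⟩, hvirt, fun e => ⟨?_, ?_⟩⟩, ?_⟩
  · have := (hγm i).2.1
    change net.dlo i ≤ z (d i)
    linarith
  · have := (hγp i).2.1
    change z (d i) ≤ net.dhi i
    linarith
  · have := (hσm e).2.1
    change _ ≤ net.innerFlow (fun j => z (ψ j)) e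
    linarith
  · have := (hσp e).2.1
    change net.innerFlow (fun j => z (ψ j)) e ≤ _
    linarith
  intro d' ω' P' ψ' h'
  have hcost : ∀ i, c i (z (d i)) + deriv (c i) (z (d i)) * (d' i - z (d i)) ≤ c i (d' i) :=
    fun i => (hconv i).add_deriv_mul_le ((hC1 i).differentiable one_ne_zero _) _
  have hderiv : ∀ i, deriv (c i) (z (d i)) = z (μ i) - z (γp i) + z (γm i) := fun i => by
    have h := field_eq_zero hz (k := d i) (by simp [multipliers])
    simp only [field, freq_eq_zero hz i] at h
    linarith
  -- stationarity in `ψ`, tested with the difference of the two virtual phase angles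
  have hstat : ∑ e : ↥net.Ein, (net.innerFlow ψ' e - net.innerFlow (fun j => z (ψ j)) e) *
      (z (μ e.1.1) - z (μ e.1.2) - z (σp e) + z (σm e)) = 0 := by
    have h := sum_mul_netOutflow (fun i => ψ' i - z (ψ i)) (fun e : ↥net.Ein =>
      net.B e.1.1 e.1.2 * (z (μ e.1.1) - z (μ e.1.2) - z (σp e) + z (σm e)))
    rw [Finset.sum_eq_zero fun i _ => by
      have h1 := field_eq_zero hz (k := ψ i) (by simp [multipliers])
      simp only [field] at h1
      rw [h1, mul_zero]] at h
    rw [h]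
    refine Finset.sum_congr rfl fun e _ => ?_
    simp only [Network.innerFlow]
    ring
  have hμ : ∑ i, z (μ i) * (d' i - z (d i)) = -∑ e : ↥net.Ein, (z (μ e.1.1) - z (μ e.1.2)) *
      (net.innerFlow ψ' e - net.innerFlow (fun j => z (ψ j)) e) := by
    rw [← sum_mul_netOutflow (fun i => z (μ i)), ← Finset.sum_neg_distrib]
    refine Finset.sum_congr rfl fun i _ => ?_
    rw [netOutflow_sub, h'.virtual_balance i, hvirt i]
    ring
  have hσ : ∑ e : ↥net.Ein, (net.innerFlow ψ' e - net.innerFlow (fun j => z (ψ j)) e) *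
      (z (σp e) - z (σm e)) ≤ 0 := by
    refine Finset.sum_nonpos fun e _ => ?_
    have h1 := h'.thermal_limits e
    nlinarith [hσp e, hσm e, mul_nonneg (hσp e).1 (sub_nonneg.2 h1.2),
      mul_nonneg (hσm e).1 (sub_nonneg.2 h1.1)]
  have hγ : 0 ≤ ∑ i, (-z (γp i) + z (γm i)) * (d' i - z (d i)) := by
    refine Finset.sum_nonneg fun i _ => ?_
    have h1 := h'.load_limits i
    nlinarith [hγp i, hγm i, mul_nonneg (hγp i).1 (sub_nonneg.2 h1.2),
      mul_nonneg (hγm i).1 (sub_nonneg.2 h1.1)]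
  have hfirst : 0 ≤ ∑ i, deriv (c i) (z (d i)) * (d' i - z (d i)) := by
    have h1 : ∑ i, deriv (c i) (z (d i)) * (d' i - z (d i)) = ∑ i, z (μ i) * (d' i - z (d i))
        + ∑ i, (-z (γp i) + z (γm i)) * (d' i - z (d i)) := by
      rw [← Finset.sum_add_distrib]
      refine Finset.sum_congr rfl fun i _ => ?_
      rw [hderiv i]
      ring
    have h2 : ∑ e : ↥net.Ein, (net.innerFlow ψ' e - net.innerFlow (fun j => z (ψ j)) e) *
        (z (μ e.1.1) - z (μ e.1.2) - z (σp e) + z (σm e))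
        = ∑ e : ↥net.Ein, (z (μ e.1.1) - z (μ e.1.2)) *
          (net.innerFlow ψ' e - net.innerFlow (fun j => z (ψ j)) e)
        - ∑ e : ↥net.Ein, (net.innerFlow ψ' e - net.innerFlow (fun j => z (ψ j)) e) *
          (z (σp e) - z (σm e)) := by
      rw [← Finset.sum_sub_distrib]
      exact Finset.sum_congr rfl fun e _ => by ring
    linarith
  have hω' : 0 ≤ ∑ i, 1 / 2 * net.D i * ω' i ^ 2 := Finset.sum_nonneg fun i _ => by
    have := net.D_pos i
    positivity
  have hω0 : ∑ i, 1 / 2 * net.D i * (toState g z).ω i ^ 2 = 0 :=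
    Finset.sum_eq_zero fun i _ => by
      have : (toState g z).ω i = 0 := freq_eq_zero hz i
      rw [this]
      ring
  have hsum := Finset.sum_le_sum fun i (_ : i ∈ Finset.univ) => hcost i
  rw [Finset.sum_add_distrib] at hsum
  have hd : ∑ i, c i ((toState g z).d i) = ∑ i, c i (z (d i)) := rfl
  simp only [Network.opCost, hω0, hd]
  linarith

/-! ### The invariance argument -/

theorem _root_.eq_zero_of_affine_sq_bounded {a k M : ℝ} (h : ∀ t : ℝ, 0 ≤ t → (a + k * t) ^ 2 ≤ M) :
    k = 0 := by
  by_contra hk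
  have hM : 0 ≤ M := (sq_nonneg _).trans (h 0 le_rfl)
  have hk' : 0 < |k| := abs_pos.2 hk
  have h1 := Real.abs_le_sqrt (h ((|a| + √M + 1) / |k|) (by positivity))
  have h2 : |k * ((|a| + √M + 1) / |k|)| = |a| + √M + 1 := by
    rw [abs_mul, abs_of_nonneg (a := (|a| + √M + 1) / |k|) (by positivity)]
    field_simp
  have h3 := abs_sub_abs_le_abs_sub (k * ((|a| + √M + 1) / |k|)) (-a)
  rw [abs_neg, h2, sub_neg_eq_add, add_comm _ a] at h3
  linarith

/-- Virtual phase angles with the same net outflows have the same flows. -/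
theorem innerFlow_eq_of_netOutflow_eq {θ θ' : N → ℝ}
    (h : ∀ i, netOutflow (net.innerFlow θ) i = netOutflow (net.innerFlow θ') i) (e : ↥net.Ein) :
    net.innerFlow θ e = net.innerFlow θ' e := by
  have hB : ∀ e : ↥net.Ein, 0 < net.B e.1.1 e.1.2 := fun e =>
    net.B_pos _ _ (Finset.filter_subset _ _ e.2)
  have h1 := sum_mul_netOutflow (fun i => θ i - θ' i)
    (fun e : ↥net.Ein => net.innerFlow θ e - net.innerFlow θ' e)
  rw [Finset.sum_eq_zero fun i _ => by rw [netOutflow_sub, h i, sub_self, mul_zero]] at h1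
  have h2 : ∀ e : ↥net.Ein, ((θ e.1.1 - θ' e.1.1) - (θ e.1.2 - θ' e.1.2)) *
      (net.innerFlow θ e - net.innerFlow θ' e)
      = net.B e.1.1 e.1.2 * ((θ e.1.1 - θ' e.1.1) - (θ e.1.2 - θ' e.1.2)) ^ 2 := fun e => by
    simp only [Network.innerFlow]
    ring
  simp only [h2] at h1
  have h3 := (Finset.sum_eq_zero_iff_of_nonneg fun e _ =>
    mul_nonneg (hB e).le (sq_nonneg _)).1 h1.symm e (Finset.mem_univ e)
  have h4 := pow_eq_zero_iff (two_ne_zero) |>.1 ((mul_eq_zero.1 h3).resolve_left (hB e).ne')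
  simp only [Network.innerFlow]
  linear_combination net.B e.1.1 e.1.2 * h4

/-- A solution that keeps its distance from an equilibrium starts at an equilibrium.  Since nothing
is dissipated, the loads are optimal and the frequencies vanish; then `P`, `γ` and `μ` are constant,
so the net outflows of the virtual flows, and hence these flows themselves, are constant.  This
leaves no room for oscillations of `σ` and `ψ`: the former is constant, and the latter is affine in
time and bounded. -/
theorem isProjEquilibrium_of_energy_const (hm : ∀ i, StrictMono (deriv (c i)))
    (hC1 : ∀ i, ContDiff ℝ 1 (c i)) {z : Coord net → ℝ}
    (hz : IsProjEquilibrium (multipliers net) (field c) z) {y : ℝ → Coord net → ℝ}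
    (hy : IsProjSolution (step g) (multipliers net) (field c) y)
    (hy0 : ∀ k ∈ multipliers net, 0 ≤ y 0 k)
    (hconst : ∀ t, 0 ≤ t → energy (step g) (y t - z) = energy (step g) (y 0 - z)) :
    IsProjEquilibrium (multipliers net) (field c) (y 0) := by
  have hFc := continuous_field (net := net) hC1
  have hcont : ∀ k, ContinuousOn (fun t => field c (y t) k) (Ici 0) := fun k =>
    ((continuous_apply k).comp hFc).comp_continuousOn hy.continuousOn
  have hkey := fun t (ht : 0 ≤ t) => hy.of_energy_const (step_pos g)
    (dissipative_field fun i => (hm i).monotone) hFc hz hy0 hconst ht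
  have hnn := fun t (ht : 0 ≤ t) => hy.nonneg (step_pos g) hy0 ht
  -- a free coordinate that is constant has zero field
  have hfree : ∀ k ∉ multipliers net, (∀ t, 0 ≤ t → y t k = y 0 k) →
      ∀ t, 0 ≤ t → field c (y t) k = 0 := by
    intro k hk hc t ht
    refine (hy k).rate_eq_zero_of_const hc (hcont k) (fun s _ h0 => ?_) ht
    rw [projField_of_free _ _ hk] at h0
    exact (mul_eq_zero.1 h0).resolve_left (step_pos g k).ne'
  -- a multiplier at which the field is that of `z` does not move
  have hmult : ∀ k ∈ multipliers net, (∀ t, 0 ≤ t → field c (y t) k = field c z k) →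
      ∀ t, 0 ≤ t → projField (multipliers net) (field c) (y t) k = 0 := by
    intro k hk h t ht
    rw [projField_of_multiplier _ hk, h t ht]
    exact (posProj_eq_zero_iff (hnn t ht k hk)).2 ((hkey t ht).2 k hk)
  have hrate : ∀ k, (∀ t, 0 ≤ t → projField (multipliers net) (field c) (y t) k = 0) →
      ∀ t, 0 ≤ t → y t k = y 0 k := fun k h t ht =>
    (hy k).eq_of_rate_eq_zero (fun s hs => by rw [h s hs, mul_zero]) ht
  have hdω : ∀ t, 0 ≤ t → (∀ i, y t (d i) = z (d i)) ∧ ∀ i, freq (y t) i = 0 := by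
    intro t ht
    have h := (hkey t ht).1
    rw [sum_field_sub_mul_sub] at h
    have hd0 : ∀ i ∈ (Finset.univ : Finset N),
        0 ≤ (deriv (c i) (y t (d i)) - deriv (c i) (z (d i))) * (y t (d i) - z (d i)) := by
      intro i _
      rcases le_total (y t (d i)) (z (d i)) with h | h
      · exact mul_nonneg_of_nonpos_of_nonpos (sub_nonpos.2 ((hm i).monotone h)) (sub_nonpos.2 h)
      · exact mul_nonneg (sub_nonneg.2 ((hm i).monotone h)) (sub_nonneg.2 h)
    have hω0 : ∀ i ∈ (Finset.univ : Finset N), 0 ≤ net.D i * (freq (y t) i - freq z i) ^ 2 :=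
      fun i _ => mul_nonneg (net.D_pos i).le (sq_nonneg _)
    have h1 := Finset.sum_nonneg hd0
    have h2 := Finset.sum_nonneg hω0
    refine ⟨fun i => ?_, fun i => ?_⟩
    · have h3 := (Finset.sum_eq_zero_iff_of_nonneg hd0).1 (by linarith) i (Finset.mem_univ i)
      rcases mul_eq_zero.1 h3 with h4 | h4
      · exact (hm i).injective (sub_eq_zero.1 h4)
      · exact sub_eq_zero.1 h4
    · have h3 := (Finset.sum_eq_zero_iff_of_nonneg hω0).1 (by linarith) i (Finset.mem_univ i)
      have h4 := pow_eq_zero_iff (two_ne_zero) |>.1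
        ((mul_eq_zero.1 h3).resolve_left (net.D_pos i).ne')
      rw [freq_eq_zero hz i, sub_zero] at h4
      exact h4
  have hγp := fun i => hmult (γp i) (γp_mem i) fun t ht => by simp [field, (hdω t ht).1 i]
  have hγm := fun i => hmult (γm i) (γm_mem i) fun t ht => by simp [field, (hdω t ht).1 i]
  have hd := fun i => hfree (d i) (by simp [multipliers]) fun t ht => by
    rw [(hdω t ht).1 i, (hdω 0 le_rfl).1 i]
  have hω := fun i => hfree (ω i) (by simp [multipliers]) fun t ht => by
    have h : ∀ x : Coord net → ℝ, x (ω i) = freq x i := fun x => by simp [freq]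
    rw [h (y t), h (y 0), (hdω t ht).2, (hdω 0 le_rfl).2]
  have hμc : ∀ i, ∀ t, 0 ≤ t → y t (μ i) = y 0 (μ i) := by
    intro i t ht
    have h1 := hd i t ht
    have h2 := hd i 0 le_rfl
    simp only [field, (hdω t ht).1 i, (hdω 0 le_rfl).1 i, (hdω t ht).2 i, (hdω 0 le_rfl).2 i,
      hrate _ (hγp i) t ht, hrate _ (hγm i) t ht] at h1 h2
    linarith
  have hμ := fun i => hfree (μ i) (by simp [multipliers]) (hμc i)
  have hflow : ∀ t, 0 ≤ t → ∀ e : ↥net.Ein,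
      net.innerFlow (fun j => y t (ψ j)) e = net.innerFlow (fun j => z (ψ j)) e := by
    intro t ht
    refine innerFlow_eq_of_netOutflow_eq fun i => ?_
    have h1 := hμ i t ht
    have h2 := field_eq_zero hz (k := μ i) (by simp [multipliers])
    simp only [field, (hdω t ht).1 i] at h1 h2
    linarith
  have hσp := fun e => hmult (σp e) (σp_mem e) fun t ht => by simp only [field, hflow t ht e]
  have hσm := fun e => hmult (σm e) (σm_mem e) fun t ht => by simp only [field, hflow t ht e]
  have hψ : ∀ i, field c (y 0) (ψ i) = 0 := by
    intro i
    have h1 : ∀ t, 0 ≤ t → y t (ψ i) = y 0 (ψ i) + step (net := net) g (ψ i) * field c (y 0) (ψ i) * t :=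
      fun t ht => (hy (ψ i)).eq_affine_of_rate_eq_const (fun s hs => by
        rw [projField_of_free _ _ (by simp [multipliers])]
        simp only [field, hμc _ s hs, hrate _ (hσp _) s hs, hrate _ (hσm _) s hs]) ht
    have h2 := eq_zero_of_affine_sq_bounded (a := y 0 (ψ i) - z (ψ i))
      (k := step (net := net) g (ψ i) * field c (y 0) (ψ i))
      (M := step (net := net) g (ψ i) * energy (step g) (y 0 - z)) fun t ht => by
        have h3 := sq_le_mul_energy (step_pos g) (y t - z) (ψ i)
        rw [hconst t ht, Pi.sub_apply, h1 t ht] at h3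
        convert h3 using 2
        ring
    exact (mul_eq_zero.1 h2).resolve_left (step_pos g _).ne'
  refine ⟨hy0, fun k => ?_⟩
  cases k with
  | d i => rw [projField_of_free _ _ (by simp [multipliers]), hd i 0 le_rfl]
  | ω i => rw [projField_of_free _ _ (by simp [multipliers]), hω i 0 le_rfl]
  | P e =>
    rw [projField_of_free _ _ (by simp [multipliers])]
    simp [field, (hdω 0 le_rfl).2]
  | ψ i => rw [projField_of_free _ _ (by simp [multipliers]), hψ i]
  | μ i => rw [projField_of_free _ _ (by simp [multipliers]), hμ i 0 le_rfl]
  | γp i => exact hγp i 0 le_rfl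
  | γm i => exact hγm i 0 le_rfl
  | σp e => exact hσp e 0 le_rfl
  | σm e => exact hσm e 0 le_rfl

end Coord

end

/-! ### Existence of multipliers -/

/-- Farkas' lemma: a linear form that is nonpositive where finitely many others are, is a nonnegative
combination of them.  In the induction step, all forms are restricted to the kernel of the new one by
means of the projection along a vector that shows that this form is needed. -/
theorem exists_nonneg_combination {V κ : Type*} [AddCommGroup V] [Module ℝ V] (s : Finset κ)
    (a : κ → V →ₗ[ℝ] ℝ) (f : V →ₗ[ℝ] ℝ) (h : ∀ v, (∀ k ∈ s, a k v ≤ 0) → f v ≤ 0) :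
    ∃ l : κ → ℝ, (∀ k, 0 ≤ l k) ∧ ∀ v, f v = ∑ k ∈ s, l k * a k v := by
  classical
  induction s using Finset.induction_on generalizing a f with
  | empty =>
    refine ⟨0, fun _ => le_rfl, fun v => ?_⟩
    have h1 := h v (by simp)
    have h2 := h (-v) (by simp)
    rw [map_neg] at h2
    simp only [Finset.sum_empty]
    linarith
  | insert k₀ s hk₀ ih =>
    by_cases hcase : ∀ v, (∀ k ∈ s, a k v ≤ 0) → f v ≤ 0
    · obtain ⟨l, hl, hf⟩ := ih a f hcase
      refine ⟨Function.update l k₀ 0, fun k => ?_, fun v => ?_⟩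
      · by_cases hk : k = k₀
        · simp [hk]
        · simpa [hk] using hl k
      · rw [Finset.sum_insert hk₀, Function.update_self, zero_mul, zero_add, hf v]
        refine Finset.sum_congr rfl fun k hk => ?_
        rw [Function.update_of_ne (ne_of_mem_of_not_mem hk hk₀)]
    · push Not at hcase
      obtain ⟨w, hw, hfw⟩ := hcase
      have haw : 0 < a k₀ w := by
        by_contra! hle
        refine absurd (h w fun k hk => ?_) (not_le.2 hfw)
        rcases Finset.mem_insert.1 hk with rfl | hk
        · exact hle
        · exact hw k hk
      set p : V →ₗ[ℝ] V := LinearMap.id - (a k₀).smulRight ((a k₀ w)⁻¹ • w) with hp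
      have hpv : ∀ (b : V →ₗ[ℝ] ℝ) v, b (p v) = b v - a k₀ v * ((a k₀ w)⁻¹ * b w) := fun b v => by
        simp [hp]
      obtain ⟨l, hl, hf⟩ := ih (fun k => a k ∘ₗ p) (f ∘ₗ p) fun v hv => by
        refine h (p v) fun k hk => ?_
        rcases Finset.mem_insert.1 hk with rfl | hk
        · rw [hpv, inv_mul_cancel₀ haw.ne', mul_one, sub_self]
        · exact hv k hk
      set m := (a k₀ w)⁻¹ * (f w - ∑ k ∈ s, l k * a k w) with hm
      have hm0 : 0 ≤ m := by
        refine mul_nonneg (inv_nonneg.2 haw.le) (sub_nonneg.2 (le_trans ?_ hfw.le))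
        exact Finset.sum_nonpos fun k hk => mul_nonpos_of_nonneg_of_nonpos (hl k) (hw k hk)
      refine ⟨Function.update l k₀ m, fun k => ?_, fun v => ?_⟩
      · by_cases hk : k = k₀
        · simpa [hk] using hm0
        · simpa [hk] using hl k
      · rw [Finset.sum_insert hk₀, Function.update_self]
        have h1 : ∑ k ∈ s, Function.update l k₀ m k * a k v = ∑ k ∈ s, l k * a k v :=
          Finset.sum_congr rfl fun k hk => by
            rw [Function.update_of_ne (ne_of_mem_of_not_mem hk hk₀)]
        have h2 := hf v
        simp only [LinearMap.comp_apply, hpv, mul_sub, Finset.sum_sub_distrib] at h2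
        have h3 : ∑ k ∈ s, l k * (a k₀ v * ((a k₀ w)⁻¹ * a k w))
            = a k₀ v * ((a k₀ w)⁻¹ * ∑ k ∈ s, l k * a k w) := by
          rw [Finset.mul_sum, Finset.mul_sum]
          exact Finset.sum_congr rfl fun k _ => by ring
        rw [h3] at h2
        rw [h1, hm]
        linear_combination h2

/-- Lagrange multipliers at a minimum of a separable cost under affine inequality constraints
`b + a ≤ 0`, for which no constraint qualification is needed. -/
theorem exists_multipliers {N V κ : Type*} [Fintype N] [Fintype κ] [AddCommGroup V] [Module ℝ V]
    (a : κ → V →ₗ[ℝ] ℝ) {b : κ → ℝ} (hb : ∀ k, b k ≤ 0) (o : N → V →ₗ[ℝ] ℝ) {c : N → ℝ → ℝ}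
    (hc : ∀ i, Differentiable ℝ (c i)) (d : N → ℝ)
    (hmin : ∀ v, (∀ k, b k + a k v ≤ 0) → ∑ i, c i (d i) ≤ ∑ i, c i (d i + o i v)) :
    ∃ l : κ → ℝ, (∀ k, 0 ≤ l k ∧ l k * b k = 0) ∧
      ∀ v, ∑ i, deriv (c i) (d i) * o i v + ∑ k, l k * a k v = 0 := by
  classical
  set s : Finset κ := Finset.univ.filter fun k => b k = 0 with hs
  obtain ⟨l, hl, hf⟩ := exists_nonneg_combination s a
    (-∑ i, deriv (c i) (d i) • o i) fun v hv => by
      -- a direction that respects the active constraints is feasible for small steps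
      have hfeas : ∀ᶠ t : ℝ in 𝓝[>] 0, ∀ k, b k + a k (t • v) ≤ 0 := by
        refine eventually_all.2 fun k => ?_
        by_cases hk : b k = 0
        · filter_upwards [self_mem_nhdsWithin] with t ht
          rw [hk, map_smul, smul_eq_mul, zero_add]
          exact mul_nonpos_of_nonneg_of_nonpos (le_of_lt ht) (hv k (by simp [hs, hk]))
        · have h1 : Tendsto (fun t : ℝ => b k + a k (t • v)) (𝓝[>] 0) (𝓝 (b k)) := by
            have h2 : Continuous fun t : ℝ => b k + t * a k v := by fun_prop
            have h3 := (h2.tendsto 0).mono_left (nhdsWithin_le_nhds (s := Ioi 0))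
            simpa using h3
          exact (h1.eventually_lt_const (lt_of_le_of_ne (hb k) hk)).mono fun t ht => ht.le
      have hder : HasDerivAt (fun t : ℝ => ∑ i, c i (d i + t * o i v))
          (∑ i, deriv (c i) (d i) * o i v) 0 := by
        refine HasDerivAt.fun_sum fun i _ => ?_
        have h1 : HasDerivAt (fun t : ℝ => d i + t * o i v) (o i v) 0 := by
          simpa using ((hasDerivAt_id (0 : ℝ)).mul_const (o i v)).const_add (d i)
        have h2 : HasDerivAt (c i) (deriv (c i) (d i)) (d i + 0 * o i v) := by
          simpa using (hc i (d i)).hasDerivAt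
        exact h2.comp (0 : ℝ) h1
      have hslope := hder.tendsto_slope.mono_left
        (nhdsWithin_mono 0 (fun t (ht : (0 : ℝ) < t) => ht.ne') : 𝓝[>] (0 : ℝ) ≤ 𝓝[≠] 0)
      have hnonneg : 0 ≤ ∑ i, deriv (c i) (d i) * o i v := by
        refine ge_of_tendsto hslope ?_
        filter_upwards [hfeas, self_mem_nhdsWithin] with t ht ht0
        have h1 := hmin (t • v) ht
        simp only [map_smul, smul_eq_mul] at h1
        rw [slope_def_field]
        have ht0' : (0 : ℝ) < t := ht0
        refine div_nonneg ?_ (by linarith)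
        simpa using h1
      simpa [LinearMap.sum_apply] using hnonneg
  refine ⟨fun k => if k ∈ s then l k else 0, fun k => ?_, fun v => ?_⟩
  · by_cases hk : b k = 0
    · simp [hs, hk, hl k]
    · simp [hs, hk]
  · have h1 := hf v
    simp only [LinearMap.neg_apply, LinearMap.sum_apply, LinearMap.smul_apply, smul_eq_mul] at h1
    have h2 : ∑ k, (if k ∈ s then l k else 0) * a k v = ∑ k ∈ s, l k * a k v := by
      simp [ite_mul, hs, Finset.sum_filter]
    rw [h2]
    linarith

section

variable {N A : Type*} [Fintype N] [DecidableEq N] [DecidableEq A]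

/-- The flow inside the areas as a linear function of the phase angles. -/
noncomputable def Network.innerFlowLinear (net : Network N A) : (N → ℝ) →ₗ[ℝ] (↥net.Ein → ℝ) where
  toFun := net.innerFlow
  map_add' θ θ' := by
    funext e
    simp only [Network.innerFlow, Pi.add_apply]
    ring
  map_smul' r θ := by
    funext e
    simp only [Network.innerFlow, Pi.smul_apply, smul_eq_mul, RingHom.id_apply]
    ring

/-- The net outflow as a linear function of the flow. -/
noncomputable def netOutflowLinear (S : Finset (N × N)) (i : N) : (↥S → ℝ) →ₗ[ℝ] ℝ where
  toFun f := netOutflow f i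
  map_add' f f' := by simpa using! netOutflow_add_const_mul f f' 1 i
  map_smul' r f := by
    have h : netOutflow (0 : ↥S → ℝ) i = 0 := by simp [netOutflow]
    simpa [h] using! netOutflow_add_const_mul (0 : ↥S → ℝ) f r i

/-- The optimal load control problem has a minimizer: the flows range over a compact set. -/
theorem Network.exists_optimal (net : Network N A) {c : N → ℝ → ℝ} (hc : ∀ i, Continuous (c i))
    (hfeas : ∃ d θ : N → ℝ, net.OLCFeasible d θ) :
    ∃ d θ : N → ℝ, net.OLCFeasible d θ ∧
      ∀ d' θ', net.OLCFeasible d' θ' → ∑ i, c i (d i) ≤ ∑ i, c i (d' i) := by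
  set load : (↥net.Ein → ℝ) → N → ℝ := fun f i => net.Pin i - netOutflow f i with hload
  have hloadc : ∀ i, Continuous fun f => load f i := fun i =>
    continuous_const.sub (continuous_netOutflow (fun e => continuous_apply e) i)
  set K : Set (↥net.Ein → ℝ) := (LinearMap.range net.innerFlowLinear : Set _) ∩
    (univ.pi (fun e : ↥net.Ein => Icc (net.Plo e.1.1 e.1.2) (net.Phi e.1.1 e.1.2)) ∩
      {f | ∀ i, load f i ∈ Icc (net.dlo i) (net.dhi i)}) with hK
  have hKc : IsCompact K := by
    refine IsCompact.inter_left (IsCompact.inter_right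
      (isCompact_univ_pi fun _ => isCompact_Icc) ?_) (Submodule.closed_of_finiteDimensional _)
    simp only [ofPred_forall]
    exact isClosed_iInter fun i => isClosed_Icc.preimage (hloadc i)
  have hmem : ∀ d θ, net.OLCFeasible d θ → net.innerFlow θ ∈ K ∧ load (net.innerFlow θ) = d := by
    intro d θ h
    have hd : load (net.innerFlow θ) = d := funext fun i => (h.balance i).symm
    refine ⟨⟨⟨θ, rfl⟩, fun e _ => h.thermal_limits e, fun i => ?_⟩, hd⟩
    rw [hd]
    exact h.load_limits i
  obtain ⟨d₀, θ₀, h₀⟩ := hfeas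
  obtain ⟨f, hf, hmin⟩ := hKc.exists_isMinOn ⟨_, (hmem d₀ θ₀ h₀).1⟩
    (f := fun f => ∑ i, c i (load f i))
    (continuous_finsetSum _ fun i _ => (hc i).comp (hloadc i)).continuousOn
  obtain ⟨⟨θ, rfl⟩, hbox, hlim⟩ := hf
  refine ⟨load (net.innerFlow θ), θ, ⟨fun i => rfl, hlim, fun e => hbox e (mem_univ e)⟩,
    fun d' θ' h' => ?_⟩
  have h1 := hmin (hmem d' θ' h').1
  simp only [mem_ofPred_eq, (hmem d' θ' h').2] at h1
  exact h1

omit [Fintype N] in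
/-- A flow that is extended by zero to more lines has the same net outflows. -/
theorem netOutflow_extend {S T : Finset (N × N)} (hST : S ⊆ T) (f : N × N → ℝ) (i : N) :
    netOutflow (fun e : ↥T => if e.1 ∈ S then f e.1 else 0) i
      = netOutflow (fun e : ↥S => f e.1) i := by
  have h : ∀ p : N × N → N, ∑ e : ↥T with p e.1 = i, (if e.1 ∈ S then f e.1 else 0)
      = ∑ e : ↥S with p e.1 = i, f e.1 := by
    intro p
    rw [Finset.sum_filter, Finset.sum_filter,
      Finset.sum_coe_sort T (fun e => if p e = i then (if e ∈ S then f e else 0) else 0),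
      Finset.sum_coe_sort S (fun e => if p e = i then f e else 0)]
    refine ((Finset.sum_subset hST fun e _ he => by simp [he]).symm.trans ?_)
    exact Finset.sum_congr rfl fun e he => by simp [he]
  simp only [netOutflow]
  rw [h Prod.fst, h Prod.snd]

namespace Coord

variable {net : Network N A} {c : N → ℝ → ℝ}

/-- A minimizer of the optimal load control problem and its Lagrange multipliers form an equilibrium
of the closed loop. -/
theorem exists_isProjEquilibrium (hC1 : ∀ i, ContDiff ℝ 1 (c i))
    (hfeas : ∃ d θ : N → ℝ, net.OLCFeasible d θ) :
    ∃ z : Coord net → ℝ, IsProjEquilibrium (multipliers net) (field c) z := by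
  obtain ⟨dopt, θ, hopt, hmin⟩ := net.exists_optimal (fun i => (hC1 i).continuous) hfeas
  set o : N → (N → ℝ) →ₗ[ℝ] ℝ := fun i =>
    -(netOutflowLinear net.Ein i ∘ₗ net.innerFlowLinear) with ho
  have hov : ∀ i v, o i v = -netOutflow (net.innerFlow v) i := fun i v => rfl
  set fl : ↥net.Ein → (N → ℝ) →ₗ[ℝ] ℝ := fun e => LinearMap.proj e ∘ₗ net.innerFlowLinear with hfl
  have hflv : ∀ e v, fl e v = net.innerFlow v e := fun e v => rfl
  have hadd : ∀ v, net.innerFlow (θ + v) = fun e => net.innerFlow θ e + 1 * net.innerFlow v e :=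
    fun v => by
      funext e
      simp only [Network.innerFlow, Pi.add_apply]
      ring
  obtain ⟨l, hl, hstat⟩ := exists_multipliers (κ := (N ⊕ N) ⊕ (↥net.Ein ⊕ ↥net.Ein))
    (Sum.elim (Sum.elim o fun i => -o i) (Sum.elim fl fun e => -fl e))
    (b := Sum.elim (Sum.elim (fun i => dopt i - net.dhi i) fun i => -dopt i + net.dlo i)
      (Sum.elim (fun e => net.innerFlow θ e - net.Phi e.1.1 e.1.2)
        fun e => -net.innerFlow θ e + net.Plo e.1.1 e.1.2))
    (by
      rintro ((i | i) | (e | e)) <;> simp only [Sum.elim_inl, Sum.elim_inr]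
      · linarith [hopt.load_limits i]
      · linarith [hopt.load_limits i]
      · linarith [hopt.thermal_limits e]
      · linarith [hopt.thermal_limits e])
    o (fun i => (hC1 i).differentiable one_ne_zero) dopt (fun v hv => by
      refine hmin (fun i => dopt i + o i v) (θ + v) ⟨fun i => ?_, fun i => ?_, fun e => ?_⟩
      · rw [hadd, netOutflow_add_const_mul, hov, hopt.balance i]
        ring
      · have h1 := hv (.inl (.inl i))
        have h2 := hv (.inl (.inr i))
        simp only [Sum.elim_inl, Sum.elim_inr, LinearMap.neg_apply] at h1 h2
        exact ⟨by linarith, by linarith⟩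
      · have h1 := hv (.inr (.inl e))
        have h2 := hv (.inr (.inr e))
        simp only [Sum.elim_inl, Sum.elim_inr, LinearMap.neg_apply, hflv] at h1 h2
        rw [hadd]
        exact ⟨by linarith, by linarith⟩)
  set lγp : N → ℝ := fun i => l (.inl (.inl i)) with hlγp
  set lγm : N → ℝ := fun i => l (.inl (.inr i)) with hlγm
  set lσp : ↥net.Ein → ℝ := fun e => l (.inr (.inl e)) with hlσp
  set lσm : ↥net.Ein → ℝ := fun e => l (.inr (.inr e)) with hlσm
  set m : N → ℝ := fun i => deriv (c i) (dopt i) + lγp i - lγm i with hm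
  let z : Coord net → ℝ
    | d i => dopt i
    | ω _ => 0
    | P e => if e.1 ∈ net.Ein then net.B e.1.1 e.1.2 * (θ e.1.1 - θ e.1.2) else 0
    | ψ i => θ i
    | μ i => m i
    | γp i => lγp i
    | γm i => lγm i
    | σp e => lσp e
    | σm e => lσm e
  have hQ : ∀ i, netOutflow (fun e => z (P e)) i = netOutflow (net.innerFlow θ) i := fun i =>
    netOutflow_extend (Finset.filter_subset _ _)
      (fun e => net.B e.1 e.2 * (θ e.1 - θ e.2)) i
  have hfreq : ∀ i, freq z i = 0 := fun i => by
    unfold freq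
    split_ifs
    · rfl
    · rw [hQ]
      change -(dopt i - net.Pin i + _) / _ = 0
      rw [hopt.balance i]
      simp
  have hz : ∀ k ∈ multipliers net, 0 ≤ z k ∧ field c z k ≤ 0 ∧ field c z k * z k = 0 := by
    rintro k (((⟨i, rfl⟩ | ⟨i, rfl⟩) | ⟨e, rfl⟩) | ⟨e, rfl⟩)
    · have h := hl (.inl (.inl i))
      refine ⟨h.1, ?_, (mul_comm _ _).trans h.2⟩
      change dopt i - net.dhi i ≤ 0
      linarith [hopt.load_limits i]
    · have h := hl (.inl (.inr i))
      refine ⟨h.1, ?_, (mul_comm _ _).trans h.2⟩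
      change -dopt i + net.dlo i ≤ 0
      linarith [hopt.load_limits i]
    · have h := hl (.inr (.inl e))
      refine ⟨h.1, ?_, (mul_comm _ _).trans h.2⟩
      change net.innerFlow θ e - net.Phi e.1.1 e.1.2 ≤ 0
      linarith [hopt.thermal_limits e]
    · have h := hl (.inr (.inr e))
      refine ⟨h.1, ?_, (mul_comm _ _).trans h.2⟩
      change -net.innerFlow θ e + net.Plo e.1.1 e.1.2 ≤ 0
      linarith [hopt.thermal_limits e]
  have hψ : ∀ i, field c z (ψ i) = 0 := by
    intro i
    have h1 := hstat (Pi.single i 1)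
    simp only [Fintype.sum_sum_type, Sum.elim_inl, Sum.elim_inr, LinearMap.neg_apply, hov, hflv]
      at h1
    have h2 := sum_mul_netOutflow m (net.innerFlow (Pi.single i 1))
    have h3 := sum_mul_netOutflow (Pi.single i 1) (fun e : ↥net.Ein =>
      net.B e.1.1 e.1.2 * (m e.1.1 - m e.1.2 - lσp e + lσm e))
    have h4 : ∑ j, (Pi.single i 1 : N → ℝ) j * netOutflow (fun e : ↥net.Ein =>
        net.B e.1.1 e.1.2 * (m e.1.1 - m e.1.2 - lσp e + lσm e)) j = field c z (ψ i) := by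
      simp only [Pi.single_apply, ite_mul, one_mul, zero_mul, Finset.sum_ite_eq', Finset.mem_univ,
        if_true]
      rfl
    have h5 : ∑ e : ↥net.Ein, ((Pi.single i 1 : N → ℝ) e.1.1 - (Pi.single i 1 : N → ℝ) e.1.2) *
        (net.B e.1.1 e.1.2 * (m e.1.1 - m e.1.2 - lσp e + lσm e))
        = ∑ e : ↥net.Ein, (m e.1.1 - m e.1.2) * net.innerFlow (Pi.single i 1) e
          - ∑ e : ↥net.Ein, lσp e * net.innerFlow (Pi.single i 1) e
          - ∑ e : ↥net.Ein, lσm e * -net.innerFlow (Pi.single i 1) e := by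
      rw [← Finset.sum_sub_distrib, ← Finset.sum_sub_distrib]
      refine Finset.sum_congr rfl fun e _ => ?_
      simp only [Network.innerFlow]
      ring
    have h6 : ∑ j, m j * netOutflow (net.innerFlow (Pi.single i 1)) j
        = -∑ j, deriv (c j) (dopt j) * -netOutflow (net.innerFlow (Pi.single i 1)) j
          - ∑ j, lγp j * -netOutflow (net.innerFlow (Pi.single i 1)) j
          - ∑ j, lγm j * - -netOutflow (net.innerFlow (Pi.single i 1)) j := by
      rw [← Finset.sum_neg_distrib, ← Finset.sum_sub_distrib, ← Finset.sum_sub_distrib]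
      refine Finset.sum_congr rfl fun j _ => ?_
      simp only [hm]
      ring
    linarith
  refine ⟨z, fun k hk => (hz k hk).1, fun k => ?_⟩
  by_cases hk : k ∈ multipliers net
  · rw [projField_of_multiplier z hk]
    exact (posProj_eq_zero_iff (hz k hk).1).2 (hz k hk).2
  rw [projField_of_free c z hk]
  cases k with
  | d i =>
    simp only [field, hfreq i]
    change -deriv (c i) (dopt i) + (0 + m i - lγp i + lγm i) = 0
    simp only [hm]
    ring
  | ω i =>
    simp only [field, hQ]
    change -(net.D i * 0 + dopt i - net.Pin i + _) = 0
    rw [hopt.balance i]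
    ring
  | P e => simp [field, hfreq]
  | ψ i => exact hψ i
  | μ i =>
    simp only [field]
    change -dopt i + net.Pin i - netOutflow (net.innerFlow θ) i = 0
    rw [hopt.balance i]
    ring
  | _ => exact absurd (by simp [multipliers]) hk

theorem tendsto_toState {κ : Type*} {g : Gains N} {x : ℝ → State net} (hx : IsSolution g c x)
    {s : Coord net → ℝ} (hlim : Tendsto (fun t => ofState g (x t)) atTop (𝓝 s))
    {p : State net → κ → ℝ} (hp : ∀ k, Continuous fun y : Coord net → ℝ => p (toState g y) k) :
    Tendsto (fun t => p (x t)) atTop (𝓝 (p (toState g s))) := by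
  refine (((continuous_pi hp).tendsto s).comp hlim).congr' ?_
  filter_upwards [eventually_ge_atTop (0 : ℝ)] with t ht
  change p (toState g (ofState g (x t))) = p (x t)
  rw [toState_ofState g fun i hi => (hx.balance t ht i hi).symm]

theorem convergesTo_toState {g : Gains N} {x : ℝ → State net} (hx : IsSolution g c x)
    {s : Coord net → ℝ} (hlim : Tendsto (fun t => ofState g (x t)) atTop (𝓝 s)) :
    ConvergesTo x (toState g s) where
  d := tendsto_toState hx hlim fun _ => continuous_apply _
  ω := tendsto_toState hx hlim continuous_freq
  P := tendsto_toState hx hlim fun _ => continuous_apply _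
  ψ := tendsto_toState hx hlim fun _ => continuous_apply _
  γp := tendsto_toState hx hlim fun _ => continuous_apply _
  γm := tendsto_toState hx hlim fun _ => continuous_apply _
  r := tendsto_toState hx hlim fun i => by
    have := continuous_freq (net := net) i
    simp only [toState]
    split_ifs <;> fun_prop
  σp := tendsto_toState hx hlim fun _ => continuous_apply _
  σm := tendsto_toState hx hlim fun _ => continuous_apply _

end Coord

end

end ALC

open ALC Coord in
theorem theorem1 {N A : Type*} [Fintype N] [DecidableEq N] [DecidableEq A]
    (net : ALC.Network N A) (g : ALC.Gains N) (c : N → ℝ → ℝ)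
    (hconv : ∀ i, StrictConvexOn ℝ Set.univ (c i))
    (hC1 : ∀ i, ContDiff ℝ 1 (c i))
    (hfeas : ∃ d θ : N → ℝ, net.OLCFeasible d θ)
    (s₀ : ALC.State net) (hs₀ : s₀.Admissible) :
    (∃ x : ℝ → ALC.State net, ALC.IsSolution g c x ∧ x 0 = s₀) ∧
      ∀ x : ℝ → ALC.State net, ALC.IsSolution g c x → x 0 = s₀ →
        ∃ s : ALC.State net, ALC.ConvergesTo x s ∧ s.IsEquilibrium g c ∧
          net.IsOptimal c s.d s.ω s.P s.ψ ∧ ∀ i, s.ω i = 0 := by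
  have hm : ∀ i, StrictMono (deriv (c i)) := fun i => by
    have h := (hconv i).strictMonoOn_deriv
      fun x _ => (hC1 i).differentiable one_ne_zero x
    exact strictMonoOn_univ.1 h
  have hF := continuous_field (net := net) hC1
  have hdF := dissipative_field (net := net) fun i => (hm i).monotone
  have hcost : ∀ k : Coord net, ContDiff ℝ 1 (cost c k) := by
    rintro (i | i | i | i | i | i | i | i | i)
    exacts [hC1 i, contDiff_const, contDiff_const, contDiff_const, contDiff_const, contDiff_const,
      contDiff_const, contDiff_const, contDiff_const]
  have hcostm : ∀ k : Coord net, Monotone (deriv (cost c k)) := by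
    have h0 : Monotone (deriv fun _ : ℝ => (0 : ℝ)) := by simp [monotone_const]
    rintro (i | i | i | i | i | i | i | i | i)
    exacts [(hm i).monotone, h0, h0, h0, h0, h0, h0, h0, h0]
  have hd0 : Dissipative (field (net := net) fun _ _ => 0) :=
    dissipative_field fun i => by simp [monotone_const]
  obtain ⟨z, hz⟩ := exists_isProjEquilibrium hC1 hfeas
  have hex : ∀ x₀ : Coord net → ℝ, (∀ k ∈ multipliers net, 0 ≤ x₀ k) →
      ∃ x, IsProjSolution (step g) (multipliers net) (field c) x ∧ x 0 = x₀ := fun x₀ hx₀ =>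
    exists_isProjSolution (step_pos g) hcost hcostm contDiff_field_zero hd0 (field_eq c) hdF hF hz
      hx₀
  have h₀ : ∀ k ∈ multipliers net, 0 ≤ ofState g s₀ k := by
    rintro k (((⟨i, rfl⟩ | ⟨i, rfl⟩) | ⟨e, rfl⟩) | ⟨e, rfl⟩)
    exacts [hs₀.γp_nonneg i, hs₀.γm_nonneg i, hs₀.σp_nonneg e, hs₀.σm_nonneg e]
  refine ⟨?_, fun x hx hx0 => ?_⟩
  · obtain ⟨y, hy, hy0⟩ := hex _ h₀
    refine ⟨fun t => toState g (y t), isSolution_toState hy, ?_⟩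
    change toState g (y 0) = s₀
    rw [hy0, toState_ofState g hs₀.balance]
  obtain ⟨s, hs, hlim⟩ := (isProjSolution_ofState hx).exists_tendsto (step_pos g) hdF hex hz
    (fun y hy hy0 hc => isProjEquilibrium_of_energy_const hm hC1 hz hy hy0 hc)
    (by rw [hx0]; exact h₀)
  exact ⟨toState g s, convergesTo_toState hx hlim, isEquilibrium_toState hs,
    isOptimal_toState (fun i => (hconv i).convexOn) hC1 hs, freq_eq_zero hs⟩
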